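/- Let $n\ge 1$. A convex body in $\mathbb{R}^n$ is a compact convex set with nonempty interior; $B_2^n$ is the Euclidean unit ball. For a Borel measure $\mu$ on $\mathbb{R}^n$ and a convex body $A\subset\mathbb{R}^n$ put $$\mu^+(\partial A)=\liminf_{\varepsilon\to0^+}\frac{\mu\big((A+\varepsilon B_2^n)\setminus A\big)}{\varepsilon},\qquad \Gamma(\mu)=\sup\{\mu^+(\partial A): A\subset\mathbb{R}^n\text{ a convex body}\}.$$ The surface area $S(K)$ of a convex body $K$ is the $(n-1)$-dimensional Hausdorff measure of its boundary $\partial K$ (normalised to agree with Lebesgue measure in dimension $n-1$). A convex body $K$ is called isotropic if it has volume $1$, its barycenter is at the origin, and there is a constant $L_K>0$, its isotropic constant, such that $\int_K\langle x,\xi\rangle^2\,dx=L_K^2$ for every unit vector $\xi\in\mathbb{R}^n$; in that case let $\mu_K$ be the measure on $\mathbb{R}^n$ with density $L_K^n\,\mathbf 1_{K/L_K}$ with respect to Lebesgue measure. (i) For every isotropic convex body $K$ in $\mathbb{R}^n$, $$\Gamma(\mu_K)=L_K\,S(K),\qquad\text{and}\qquad \Gamma(\mu_K)\le\sqrt{\frac{n}{n+2}}\;n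 .$$ (ii) If moreover $K$ is a regular simplex (the convex hull of $n+1$ affinely independent points with equal pairwise distances), then $\Gamma(\mu_K)=\sqrt{\frac{n}{n+2}}\;n$. Isotropic regular simplices exist in $\mathbb{R}^n$, so the bound in (i) is sharp in every dimension. -/

import Mathlib

open MeasureTheory Set Filter Topology
open scoped Pointwise ENNReal

noncomputable section

namespace MaxPerimeter

/-- A convex body in `ℝⁿ`: a compact convex set with nonempty interior. -/
def IsConvexBody {n : ℕ} (K : Set (EuclideanSpace ℝ (Fin n))) : Prop :=
  Convex ℝ K ∧ IsCompact K ∧ (interior K).Nonempty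

/-- The `μ`-perimeter of `A`, i.e.
`μ⁺(∂A) = liminf_{ε → 0⁺} μ((A + ε B₂ⁿ) \ A) / ε`, with values in `[0, ∞]`. -/
def perimeter {n : ℕ} (μ : Measure (EuclideanSpace ℝ (Fin n)))
    (A : Set (EuclideanSpace ℝ (Fin n))) : ℝ≥0∞ :=
  liminf (fun ε : ℝ =>
      μ ((A + ε • Metric.closedBall (0 : EuclideanSpace ℝ (Fin n)) 1) \ A) / ENNReal.ofReal ε)
    (𝓝[>] (0 : ℝ))

/-- The maximal perimeter constant `Γ(μ)`: the supremum (in `[0, ∞]`) of the `μ`-perimeters of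
all convex bodies. -/
def maxPerimeter {n : ℕ} (μ : Measure (EuclideanSpace ℝ (Fin n))) : ℝ≥0∞ :=
  ⨆ (A : Set (EuclideanSpace ℝ (Fin n))) (_ : IsConvexBody A), perimeter μ A

/-- The surface area `S(K)`: the `(n-1)`-dimensional Hausdorff measure of the boundary of `K`,
normalised so as to agree with Lebesgue measure on `(n-1)`-dimensional Euclidean spaces
(used for `1 ≤ n` only). -/
def surfaceArea {n : ℕ} (K : Set (EuclideanSpace ℝ (Fin n))) : ℝ≥0∞ :=
  Measure.euclideanHausdorffMeasure (n - 1) (frontier K)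

/-- `L > 0` is the isotropic constant of `K`: `∫_K ⟨x, ξ⟩² dx = L²` for all unit vectors `ξ`.
For `1 ≤ n` there is at most one such `L`. -/
def IsIsotropicConstant {n : ℕ} (K : Set (EuclideanSpace ℝ (Fin n))) (L : ℝ) : Prop :=
  0 < L ∧ ∀ ξ : EuclideanSpace ℝ (Fin n), ‖ξ‖ = 1 → ∫ x in K, (inner ℝ x ξ) ^ 2 = L ^ 2

/-- An isotropic convex body: a convex body of volume one, with barycentre at the origin, whose
covariance matrix is a multiple of the identity (i.e. which has an isotropic constant). -/
def IsIsotropicBody {n : ℕ} (K : Set (EuclideanSpace ℝ (Fin n))) : Prop :=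
  IsConvexBody K ∧ volume K = 1 ∧ ∫ x in K, x = 0 ∧ ∃ L : ℝ, IsIsotropicConstant K L

/-- The measure `μ_K` with density `Lⁿ 1_{K/L}`, where `L` is the isotropic constant of `K`. -/
def bodyMeasure {n : ℕ} (K : Set (EuclideanSpace ℝ (Fin n))) (L : ℝ) :
    Measure (EuclideanSpace ℝ (Fin n)) :=
  volume.withDensity ((L⁻¹ • K).indicator fun _ => ENNReal.ofReal (L ^ n))

/-- A regular simplex in `ℝⁿ`: the convex hull of `n + 1` affinely independent points with all
pairwise distances equal. -/
def IsRegularSimplex {n : ℕ} (K : Set (EuclideanSpace ℝ (Fin n))) : Prop :=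
  ∃ s : Affine.Simplex ℝ (EuclideanSpace ℝ (Fin n)) n,
    s.Equilateral ∧ K = convexHull ℝ (Set.range s.points)

end MaxPerimeter

end

/-! Put C = K/L. Since `bodyMeasure K L` has constant density on C, the perimeter of A only sees the
part of the collar of A inside C. Pushing each point of C \ A away from A by ε, along the line from
its nearest point in A, does not decrease distances and lands in (C + εB) \ (A + εB). Hence that
part of the collar has at most the volume of the collar of C (`volume_inter_parallelBody_diff_le`),
and no A beats Lⁿ times the outer Minkowski content of C. The dilates tC with t ↑ 1 approach this
value, which by scaling is L times the content of K (`maxPerimeter_bodyMeasure`). Content equals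
surface area (`perimeter_volume_eq_surfaceArea`): for a polytope the collar is, up to o(ε), a union
of prisms over the facets. A general body is squeezed between polytopes and dilates, both quantities
being monotone. For the bound, if K has volume one and contains rB, then K + εB ⊆ (1 + ε/r)K, so the
content is at most n/r. An isotropic K contains the ball of radius r = L√((n+2)/n). Indeed, if ⟨x,
ξ⟩ ≤ b on K, then b − ⟨x, ξ⟩ is nonnegative with mean b and second moment b² + L². By
Brunn–Minkowski its distribution function crosses that of a cone of the same mean at most once, from
above, so its second moment is at most the cone's, 2(n+1)b²/(n+2). This says L² ≤ n b²/(n+2).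
Barycentric coordinates of a simplex have exactly the cone distribution. All facets of an isotropic
simplex are therefore at distance r from the origin, and its content is n/r. For the centred regular
simplex, the reflections swapping two vertices force the barycentre to vanish and the inertia form
to be scalar. -/

namespace MaxPerimeter

/-! ### Nearest-point maps and parallel bodies -/

section MetricProjection

variable {E : Type*} [NormedAddCommGroup E] [InnerProductSpace ℝ E]

/-- `P` is the nearest-point map of the convex set `A`. -/
def IsMetricProj (A : Set E) (P : E → E) : Prop :=
  ∀ x, P x ∈ A ∧ ∀ a ∈ A, inner ℝ (x - P x) (a - P x) ≤ 0

theorem exists_isMetricProj [CompleteSpace E] {A : Set E} (hA : Convex ℝ A) (hc : IsClosed A)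
    (hne : A.Nonempty) : ∃ P, IsMetricProj A P := by
  have h : ∀ x : E, ∃ p, p ∈ A ∧ ∀ a ∈ A, inner ℝ (x - p) (a - p) ≤ 0 := fun x ↦ by
    obtain ⟨p, hp, h⟩ := exists_norm_eq_iInf_of_complete_convex hne hc.isComplete hA x
    exact ⟨p, hp, (norm_eq_iInf_iff_real_inner_le_zero hA hp).1 h⟩
  choose P hP using h
  exact ⟨P, hP⟩

theorem IsMetricProj.inner_nonneg {A : Set E} {P : E → E} (h : IsMetricProj A P) (x y : E) :
    0 ≤ inner ℝ (x - P x) (P x - P y) := by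
  have := (h x).2 _ (h y).1
  rw [← neg_sub (P x) (P y), inner_neg_right] at this
  linarith

theorem IsMetricProj.eq_of_inner_le {A : Set E} {P : E → E} (h : IsMetricProj A P) {x p : E}
    (hp : p ∈ A) (hx : ∀ a ∈ A, inner ℝ (x - p) (a - p) ≤ 0) : P x = p := by
  have h1 := (h x).2 p hp
  have h2 := hx _ (h x).1
  have h3 : inner ℝ (P x - p) (P x - p) = inner ℝ (x - P x) (p - P x) + inner ℝ (x - p) (P x - p) := by
    simp only [inner_sub_left, inner_sub_right]; ring
  have h4 : inner ℝ (P x - p) (P x - p) ≤ 0 := by linarith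
  rw [real_inner_self_eq_norm_sq] at h4
  exact sub_eq_zero.1 (norm_eq_zero.1 (pow_eq_zero_iff two_ne_zero |>.1 (le_antisymm h4 (sq_nonneg _))))

theorem IsMetricProj.norm_sub_le {A : Set E} {P : E → E} (h : IsMetricProj A P) {x a : E}
    (ha : a ∈ A) : ‖x - P x‖ ≤ ‖x - a‖ := by
  have h1 := (h x).2 a ha
  have h2 : ‖x - a‖ ^ 2 = ‖x - P x‖ ^ 2 + ‖a - P x‖ ^ 2 - 2 * inner ℝ (x - P x) (a - P x) := by
    rw [show x - a = (x - P x) - (a - P x) by abel, norm_sub_sq_real]; ring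
  nlinarith [norm_nonneg (x - a), norm_nonneg (x - P x), sq_nonneg ‖a - P x‖]

theorem IsMetricProj.lipschitz {A : Set E} {P : E → E} (h : IsMetricProj A P) :
    LipschitzWith 1 P := by
  refine LipschitzWith.of_dist_le_mul fun x y ↦ ?_
  rw [dist_eq_norm, dist_eq_norm, NNReal.coe_one, one_mul]
  have h1 := h.inner_nonneg x y
  have h2 := h.inner_nonneg y x
  have h3 : inner ℝ (x - y) (P x - P y) = ‖P x - P y‖ ^ 2 + inner ℝ (x - P x) (P x - P y)
      + inner ℝ (y - P y) (P y - P x) := by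
    rw [← real_inner_self_eq_norm_sq]
    simp only [inner_sub_left, inner_sub_right]; ring
  have h4 := real_inner_le_norm (x - y) (P x - P y)
  by_contra! hlt
  nlinarith [norm_nonneg (x - y), norm_nonneg (P x - P y)]

/-- Moving points outside of a convex set away from it by a fixed amount does not decrease
distances. -/
theorem IsMetricProj.norm_sub_le_push {A : Set E} {P : E → E} (h : IsMetricProj A P) {ε : ℝ}
    (hε : 0 ≤ ε) {x y : E} (hx : x ∉ A) (hy : y ∉ A) :
    ‖x - y‖ ≤ ‖(x + (ε / ‖x - P x‖) • (x - P x)) - (y + (ε / ‖y - P y‖) • (y - P y))‖ := by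
  have hx0 : x - P x ≠ 0 := fun h0 ↦ hx (by rw [sub_eq_zero.1 h0]; exact (h x).1)
  have hy0 : y - P y ≠ 0 := fun h0 ↦ hy (by rw [sub_eq_zero.1 h0]; exact (h y).1)
  have ha := norm_pos_iff.2 hx0
  have hb := norm_pos_iff.2 hy0
  have h1 := h.inner_nonneg x y
  have h2 := h.inner_nonneg y x
  have hcs := real_inner_le_norm (x - P x) (y - P y)
  set a := x - P x with hadef
  set b := y - P y with hbdef
  set s := ‖a‖
  set t := ‖b‖
  have hxy : x - y = (P x - P y) + a - b := by simp only [a, b]; abel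
  -- The unit field (x − P x)/‖x − P x‖ is monotone: the two projection inequalities control the
  -- P-parts, and Cauchy–Schwarz for a and b the rest.
  have key : 0 ≤ inner ℝ ((1 / s) • a - (1 / t) • b) (x - y) := by
    have e : inner ℝ ((1 / s) • a - (1 / t) • b) (x - y) =
        (1 / s) * inner ℝ a (P x - P y) + (1 / t) * inner ℝ b (P y - P x)
        + ((1 / s) * s ^ 2 + (1 / t) * t ^ 2 - (1 / s + 1 / t) * inner ℝ a b) := by
      rw [hxy, ← real_inner_self_eq_norm_sq a, ← real_inner_self_eq_norm_sq b]
      simp only [inner_sub_left, inner_sub_right, inner_smul_left, inner_add_right,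
        real_inner_comm a b]
      simp; ring
    rw [e]
    have : (1 / s + 1 / t) * inner ℝ a b ≤ (1 / s + 1 / t) * (s * t) :=
      mul_le_mul_of_nonneg_left hcs (by positivity)
    have e2 : (1 / s) * s ^ 2 + (1 / t) * t ^ 2 = (1 / s + 1 / t) * (s * t) := by
      field_simp
      ring
    have p1 : 0 ≤ (1 / s) * inner ℝ a (P x - P y) := by positivity
    have p2 : 0 ≤ (1 / t) * inner ℝ b (P y - P x) := by positivity
    linarith
  have e3 : (x + (ε / s) • a) - (y + (ε / t) • b) =
      (x - y) + ε • ((1 / s) • a - (1 / t) • b) := by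
    rw [smul_sub ε, smul_smul ε, smul_smul ε, mul_one_div, mul_one_div]; abel
  rw [e3]
  have h5 : ‖x - y‖ ^ 2 ≤ ‖(x - y) + ε • ((1 / s) • a - (1 / t) • b)‖ ^ 2 := by
    rw [norm_add_sq_real, real_inner_comm, inner_smul_left]
    have : 0 ≤ ε * inner ℝ ((1 / s) • a - (1 / t) • b) (x - y) := mul_nonneg hε key
    simp only [conj_trivial]
    nlinarith [sq_nonneg ‖ε • ((1 / s) • a - (1 / t) • b)‖]
  exact le_of_sq_le_sq h5 (norm_nonneg _)

/-- The closed `ε`-neighbourhood of a set, written as a Minkowski sum. -/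
def parallelBody (A : Set E) (ε : ℝ) : Set E := A + ε • Metric.closedBall (0 : E) 1

theorem mem_parallelBody {A : Set E} {ε : ℝ} (hε : 0 ≤ ε) {x : E} :
    x ∈ parallelBody A ε ↔ ∃ a ∈ A, ‖x - a‖ ≤ ε := by
  rw [parallelBody, smul_unitClosedBall, Real.norm_of_nonneg hε]
  constructor
  · rintro ⟨a, ha, b, hb, rfl⟩
    exact ⟨a, ha, by simpa using hb⟩
  · rintro ⟨a, ha, h⟩
    exact ⟨a, ha, x - a, by simpa using h, by simp⟩

theorem subset_parallelBody {A : Set E} {ε : ℝ} (hε : 0 ≤ ε) : A ⊆ parallelBody A ε :=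
  fun x hx ↦ (mem_parallelBody hε).2 ⟨x, hx, by simpa using hε⟩

theorem isCompact_parallelBody [FiniteDimensional ℝ E] {A : Set E} (hA : IsCompact A) (ε : ℝ) :
    IsCompact (parallelBody A ε) := by
  have := FiniteDimensional.proper ℝ E
  exact hA.add ((isCompact_closedBall _ _).smul ε)

theorem IsMetricProj.mem_parallelBody_iff {A : Set E} {P : E → E} (h : IsMetricProj A P) {ε : ℝ}
    (hε : 0 ≤ ε) {x : E} : x ∈ parallelBody A ε ↔ ‖x - P x‖ ≤ ε := by
  rw [mem_parallelBody hε]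
  exact ⟨fun ⟨a, ha, hx⟩ ↦ (h.norm_sub_le ha).trans hx, fun hx ↦ ⟨_, (h x).1, hx⟩⟩

theorem smul_parallelBody {A : Set E} {t ε : ℝ} :
    t • parallelBody A ε = parallelBody (t • A) (t * ε) := by
  rw [parallelBody, parallelBody, smul_add, smul_smul]

end MetricProjection

/-! ### Monotonicity of collars and of surface area -/

section Monotonicity

variable {n : ℕ}

local notation "𝔼" => EuclideanSpace ℝ (Fin n)

theorem euclideanHausdorffMeasure_image_le {X Y : Type*} [EMetricSpace X] [EMetricSpace Y]
    [MeasurableSpace X] [BorelSpace X] [MeasurableSpace Y] [BorelSpace Y] {f : X → Y} {s : Set X}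
    (hf : LipschitzOnWith 1 f s) (d : ℕ) :
    Measure.euclideanHausdorffMeasure d (f '' s) ≤ Measure.euclideanHausdorffMeasure d s := by
  rw [Measure.euclideanHausdorffMeasure_def, Measure.euclideanHausdorffMeasure_def,
    Measure.smul_apply, Measure.smul_apply]
  have := hf.hausdorffMeasure_image_le (d := d) (by positivity)
  simp only [ENNReal.coe_one, ENNReal.one_rpow, one_mul] at this
  exact smul_le_smul_of_nonneg_left this zero_le

/-- The part of `C` close to a convex set `A` has at most the volume of the collar of `C`. -/
theorem volume_inter_parallelBody_diff_le {A C : Set 𝔼} (hA : Convex ℝ A) (hAc : IsCompact A)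
    (hC : IsCompact C) {ε : ℝ} (hε : 0 < ε) :
    volume (C ∩ (parallelBody A ε \ A)) ≤ volume (parallelBody C ε \ C) := by
  rcases A.eq_empty_or_nonempty with rfl | hne
  · simp [parallelBody]
  obtain ⟨P, hP⟩ := exists_isMetricProj hA hAc.isClosed hne
  -- The push away from A by ε. Its inverse is 1-Lipschitz, so it does not decrease n-dimensional
  -- Hausdorff measure, which is volume.
  set φ : 𝔼 → 𝔼 := fun x ↦ x + (ε / ‖x - P x‖) • (x - P x) with hφ
  have hexp : ∀ x ∈ C \ A, ∀ y ∈ C \ A, ‖x - y‖ ≤ ‖φ x - φ y‖ := fun x hx y hy ↦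
    hP.norm_sub_le_push hε.le hx.2 hy.2
  have hinj : InjOn φ (C \ A) := fun x hx y hy hxy ↦ by
    have := hexp x hx y hy
    rw [hxy, sub_self, norm_zero] at this
    exact sub_eq_zero.1 (norm_le_zero_iff.1 this)
  have h1 : volume (C \ A) ≤ volume (φ '' (C \ A)) := by
    have hl : LipschitzOnWith 1 (Function.invFunOn φ (C \ A)) (φ '' (C \ A)) := by
      refine LipschitzOnWith.of_dist_le_mul ?_
      rintro _ ⟨x, hx, rfl⟩ _ ⟨y, hy, rfl⟩
      rw [hinj.leftInvOn_invFunOn hx, hinj.leftInvOn_invFunOn hy, NNReal.coe_one, one_mul,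
        dist_eq_norm, dist_eq_norm]
      exact hexp x hx y hy
    have := euclideanHausdorffMeasure_image_le hl n
    rwa [hinj.leftInvOn_invFunOn.image_image, EuclideanSpace.euclideanHausdorffMeasure_eq_volume]
      at this
  have h2 : φ '' (C \ A) ⊆ parallelBody C ε \ parallelBody A ε := by
    rintro _ ⟨x, hx, rfl⟩
    have hx0 : x - P x ≠ 0 := fun h0 ↦ hx.2 (by rw [sub_eq_zero.1 h0]; exact (hP x).1)
    have hpos := norm_pos_iff.2 hx0
    refine ⟨(mem_parallelBody hε.le).2 ⟨x, hx.1, ?_⟩, ?_⟩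
    · simp only [hφ, add_sub_cancel_left, norm_smul, norm_div, norm_norm, Real.norm_of_nonneg hε.le]
      rw [div_mul_cancel₀ _ hpos.ne']
    · have hs : φ x - P x = (1 + ε / ‖x - P x‖) • (x - P x) := by
        simp only [hφ, add_smul, one_smul]; abel
      have hPφ : P (φ x) = P x := hP.eq_of_inner_le (hP x).1 fun a ha ↦ by
        rw [hs, inner_smul_left]
        exact mul_nonpos_of_nonneg_of_nonpos (by simp; positivity) ((hP x).2 a ha)
      rw [hP.mem_parallelBody_iff hε.le, hPφ, hs, norm_smul, Real.norm_of_nonneg (by positivity),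
        add_mul, div_mul_cancel₀ _ hpos.ne']
      linarith
  have hmA : MeasurableSet A := hAc.measurableSet
  have hmAε : MeasurableSet (parallelBody A ε) := (isCompact_parallelBody hAc ε).measurableSet
  -- Both sides are padded by the finite volume of C outside the parallel body of A, which is
  -- cancelled at the end.
  have h3 : volume (C ∩ (parallelBody A ε \ A)) + volume (C \ parallelBody A ε) ≤
      volume (parallelBody C ε \ C) + volume (C \ parallelBody A ε) := by
    calc _ = volume (C \ A) := by
          rw [← measure_inter_add_sdiff (C \ A) hmAε]
          congr 2
          · ext x; simp; tauto
          · ext x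
            have := @subset_parallelBody _ _ _ A ε hε.le x
            simp; tauto
      _ ≤ volume (parallelBody C ε \ parallelBody A ε) := h1.trans (measure_mono h2)
      _ ≤ _ := by
        refine (measure_mono ?_).trans (measure_union_le _ _)
        intro x hx
        by_cases hc : x ∈ C
        · exact .inr ⟨hc, hx.2⟩
        · exact .inl ⟨hx.1, hc⟩
  exact (ENNReal.add_le_add_iff_right
    ((measure_mono sdiff_subset).trans_lt hC.measure_lt_top).ne).1 h3

/-- Surface area (in any dimension) is monotone under inclusion, for an inner convex body. -/
theorem euclideanHausdorffMeasure_frontier_mono {A B : Set 𝔼} (hA : IsConvexBody A)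
    (hB : IsCompact B) (hAB : A ⊆ B) (d : ℕ) :
    Measure.euclideanHausdorffMeasure d (frontier A) ≤
      Measure.euclideanHausdorffMeasure d (frontier B) := by
  obtain ⟨hcv, hcp, hint⟩ := hA
  obtain ⟨P, hP⟩ := exists_isMetricProj hcv hcp.isClosed (hint.mono interior_subset)
  refine (measure_mono ?_).trans (euclideanHausdorffMeasure_image_le hP.lipschitz.lipschitzOnWith d)
  intro x hx
  rw [hcp.isClosed.frontier_eq] at hx
  obtain ⟨f, hf⟩ := geometric_hahn_banach_open_point hcv.interior isOpen_interior hx.2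
  obtain ⟨u, rfl⟩ := (InnerProductSpace.toDual ℝ 𝔼).surjective f
  simp only [InnerProductSpace.toDual_apply_apply] at hf
  have hle : ∀ a ∈ A, inner ℝ u a ≤ inner ℝ u x := by
    have : A ⊆ closure (interior A) := by
      rw [hcv.closure_interior_eq_closure_of_nonempty_interior hint]; exact subset_closure
    intro a ha
    have hcl : IsClosed {a : 𝔼 | inner ℝ u a ≤ inner ℝ u x} :=
      isClosed_le (by fun_prop) continuous_const
    exact hcl.closure_subset_iff.2 (fun a ha ↦ (hf a ha).le) (this ha)
  have hu : u ≠ 0 := by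
    rintro rfl
    obtain ⟨a, ha⟩ := hint
    simpa using hf a ha
  -- The last point of B on the outer normal ray at x lies on the frontier of B, and every point of
  -- this ray projects to x. So `P` maps a part of the frontier of B onto the frontier of A.
  set T : Set ℝ := {t | 0 ≤ t ∧ x + t • u ∈ B} with hT
  have hTc : IsClosed T := (isClosed_le continuous_const continuous_id).inter
    (hB.isClosed.preimage (by fun_prop))
  have hTne : T.Nonempty := ⟨0, le_rfl, by simpa using hAB hx.1⟩
  obtain ⟨R, hR⟩ := hB.isBounded.exists_norm_le
  have hTb : BddAbove T := by
    refine ⟨(R + ‖x‖) / ‖u‖, fun t ht ↦ ?_⟩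
    rw [le_div_iff₀ (norm_pos_iff.2 hu)]
    have h1 := hR _ ht.2
    have h2 : ‖t • u‖ ≤ ‖x + t • u‖ + ‖x‖ := by
      simpa using norm_sub_le (x + t • u) x
    rw [norm_smul, Real.norm_of_nonneg ht.1] at h2
    linarith
  have hmax := hTc.csSup_mem hTne hTb
  set t := sSup T
  refine ⟨x + t • u, ⟨subset_closure hmax.2, fun hin ↦ ?_⟩, ?_⟩
  · have hnear : ∀ᶠ s in 𝓝 t, x + s • u ∈ B := by
      have hc : Continuous fun s : ℝ ↦ x + s • u := by fun_prop
      exact (hc.tendsto t).eventually (mem_interior_iff_mem_nhds.1 hin)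
    obtain ⟨s, hs, hst⟩ := ((hnear.filter_mono nhdsWithin_le_nhds).and
      (self_mem_nhdsWithin : Ioi t ∈ 𝓝[>] t)).exists
    exact absurd (le_csSup hTb ⟨hmax.1.trans (le_of_lt hst), hs⟩) (not_le.2 hst)
  · refine hP.eq_of_inner_le hx.1 fun a ha ↦ ?_
    rw [add_sub_cancel_left, inner_smul_left, inner_sub_right]
    exact mul_nonpos_of_nonneg_of_nonpos (by simpa using hmax.1) (by linarith [hle a ha])

end Monotonicity

/-! ### Scaling, and the reduction to outer Minkowski content -/

section Scaling

variable {n : ℕ}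

local notation "𝔼" => EuclideanSpace ℝ (Fin n)

theorem perimeter_volume_eq (K : Set 𝔼) :
    perimeter volume K =
      liminf (fun ε : ℝ ↦ volume (parallelBody K ε \ K) / ENNReal.ofReal ε) (𝓝[>] (0 : ℝ)) := rfl

theorem IsConvexBody.smul {K : Set 𝔼} (hK : IsConvexBody K) {t : ℝ} (ht : t ≠ 0) :
    IsConvexBody (t • K) :=
  ⟨hK.1.smul t, hK.2.1.smul t, by rw [interior_smul₀ ht]; exact hK.2.2.smul_set⟩

/-- After substituting tε for ε, the collar of tK is t times the collar of K: the volume gains tⁿ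
and the denominator takes back one factor t. -/
theorem perimeter_volume_smul (hn : 1 ≤ n) (K : Set 𝔼) {t : ℝ} (ht : 0 < t) :
    perimeter volume (t • K) = ENNReal.ofReal (t ^ (n - 1)) * perimeter volume K := by
  rw [perimeter_volume_eq, perimeter_volume_eq,
    ← ENNReal.liminf_const_mul_of_ne_top ENNReal.ofReal_ne_top]
  have hmap : map (fun ε ↦ t * ε) (𝓝[>] (0 : ℝ)) = 𝓝[>] 0 := by
    conv_lhs => rw [← comap_mulLeft_nhdsGT_zero ht]
    exact map_comap_of_surjective (mul_left_surjective₀ ht.ne') _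
  conv_lhs => rw [← hmap]
  rw [← liminf_comp]
  refine liminf_congr ?_
  filter_upwards [self_mem_nhdsWithin] with ε (hε : 0 < ε)
  simp only [Function.comp_apply]
  rw [← smul_parallelBody, ← smul_set_sdiff₀ ht.ne', Measure.addHaar_smul_of_nonneg _ ht.le,
    finrank_euclideanSpace_fin, ENNReal.ofReal_mul ht.le]
  obtain ⟨m, rfl⟩ : ∃ m, n = m + 1 := ⟨n - 1, by omega⟩
  rw [Nat.add_sub_cancel, pow_succ, ENNReal.ofReal_mul (by positivity), ← mul_div_assoc,
    mul_assoc, mul_left_comm, ENNReal.mul_div_mul_left _ _ (by simpa using ht) (by simp)]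

theorem euclideanHausdorffMeasure_frontier_smul (d : ℕ) (K : Set 𝔼) {t : ℝ} (ht : 0 < t) :
    Measure.euclideanHausdorffMeasure d (frontier (t • K)) =
      ENNReal.ofReal (t ^ d) * Measure.euclideanHausdorffMeasure d (frontier K) := by
  have : frontier (t • K) = t • frontier K := by
    rw [frontier, closure_smul₀ t, interior_smul₀ ht.ne', ← smul_set_sdiff₀ ht.ne', frontier]
  rw [this, Measure.euclideanHausdorffMeasure_smul₀ d ht.ne', ENNReal.smul_def, smul_eq_mul,
    ENNReal.ofReal_pow ht.le]
  congr 1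
  rw [ENNReal.coe_pow, ENNReal.ofReal, Real.nnnorm_of_nonneg ht.le, Real.toNNReal_of_nonneg ht.le]

theorem eventually_parallelBody_subset {A B : Set 𝔼} (hA : IsCompact A) (hAB : A ⊆ interior B) :
    ∀ᶠ ε : ℝ in 𝓝[>] 0, parallelBody A ε ⊆ B := by
  obtain ⟨δ, hδ, h⟩ := hA.exists_cthickening_subset_open isOpen_interior hAB
  filter_upwards [Ioc_mem_nhdsGT hδ] with ε hε
  rw [parallelBody, smul_unitClosedBall, Real.norm_of_nonneg hε.1.le,
    hA.add_closedBall_zero hε.1.le]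
  exact (Metric.cthickening_mono hε.2 _).trans (h.trans interior_subset)

/-- For small ε the whole collar of A lies in B, so the collar comparison applies with C = B. -/
theorem perimeter_volume_mono {A B : Set 𝔼} (hA : Convex ℝ A) (hAc : IsCompact A)
    (hB : IsCompact B) (hAB : A ⊆ interior B) : perimeter volume A ≤ perimeter volume B := by
  rw [perimeter_volume_eq, perimeter_volume_eq]
  refine liminf_le_liminf ?_
  filter_upwards [self_mem_nhdsWithin, eventually_parallelBody_subset hAc hAB] with ε hε hsub
  refine ENNReal.div_le_div_right (le_trans (measure_mono ?_)
    (volume_inter_parallelBody_diff_le hA hAc hB hε)) _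
  exact fun x hx ↦ ⟨hsub hx.1, hx⟩

theorem subset_interior_smul {K : Set 𝔼} (hK : Convex ℝ K) (h0 : (0 : 𝔼) ∈ interior K) {t : ℝ}
    (ht : 1 < t) : K ⊆ interior (t • K) := by
  have := hK.subset_interior_image_homothety_of_one_lt h0 t ht
  have he : AffineMap.homothety (0 : 𝔼) t '' K = t • K := by
    rw [← image_smul]; exact image_congr fun x _ ↦ by simp [AffineMap.homothety_apply]
  rwa [he] at this

theorem smul_subset_interior {K : Set 𝔼} (hK : Convex ℝ K) (h0 : (0 : 𝔼) ∈ interior K) {t : ℝ}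
    (ht0 : 0 < t) (ht : t < 1) : t • K ⊆ interior K := by
  have h := subset_interior_smul hK h0 (one_lt_inv_iff₀.2 ⟨ht0, ht⟩)
  have h2 := smul_set_mono (a := t) h
  rwa [interior_smul₀ (inv_pos.2 ht0).ne', smul_smul, mul_inv_cancel₀ ht0.ne', one_smul] at h2

/-- Removes the dilation factor when t → 1 in the approximation arguments. -/
theorem tendsto_ofReal_pow_mul (d : ℕ) (s : Set ℝ) (a : ℝ≥0∞) :
    Tendsto (fun t : ℝ ↦ ENNReal.ofReal (t ^ d) * a) (𝓝[s] 1) (𝓝 a) := by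
  have h : Tendsto (fun t : ℝ ↦ ENNReal.ofReal (t ^ d)) (𝓝[s] 1) (𝓝 1) := by
    have := ENNReal.tendsto_ofReal ((continuous_pow d).tendsto (1 : ℝ))
    simp only [one_pow, ENNReal.ofReal_one] at this
    exact this.mono_left nhdsWithin_le_nhds
  simpa using ENNReal.Tendsto.mul_const h (.inl one_ne_zero)

theorem bodyMeasure_apply {K : Set 𝔼} (hK : IsCompact K) (L : ℝ) {X : Set 𝔼}
    (hX : MeasurableSet X) :
    bodyMeasure K L X = ENNReal.ofReal (L ^ n) * volume ((L⁻¹ • K) ∩ X) := by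
  have hm : MeasurableSet (L⁻¹ • K) := (hK.smul L⁻¹).measurableSet
  rw [bodyMeasure, withDensity_apply _ hX, lintegral_indicator hm, setLIntegral_const,
    Measure.restrict_apply hm]

/-- The collar of C = K/L has measure zero for μ_K, so C itself is no maximiser. The lower bound
comes from tC with t < 1, whose collars eventually lie inside C. -/
theorem maxPerimeter_bodyMeasure (hn : 1 ≤ n) {K : Set 𝔼} (hK : IsConvexBody K)
    (h0 : (0 : 𝔼) ∈ interior K) {L : ℝ} (hL : 0 < L) :
    maxPerimeter (bodyMeasure K L) = ENNReal.ofReal L * perimeter volume K := by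
  have hL' := inv_pos.2 hL
  set C := L⁻¹ • K with hC
  have hCb : IsConvexBody C := hK.smul hL'.ne'
  have hC0 : (0 : 𝔼) ∈ interior C := by
    rw [hC, interior_smul₀ hL'.ne']
    exact ⟨0, h0, smul_zero _⟩
  have hmC : ENNReal.ofReal (L ^ n) * perimeter volume C =
      ENNReal.ofReal L * perimeter volume K := by
    rw [hC, perimeter_volume_smul hn K hL', ← mul_assoc, ← ENNReal.ofReal_mul (by positivity)]
    obtain ⟨m, rfl⟩ : ∃ m, n = m + 1 := ⟨n - 1, by omega⟩
    congr 2
    rw [Nat.add_sub_cancel, pow_succ, mul_right_comm, ← mul_pow, mul_inv_cancel₀ hL.ne', one_pow,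
      one_mul]
  have happ : ∀ A : Set 𝔼, IsCompact A → perimeter (bodyMeasure K L) A = ENNReal.ofReal (L ^ n) *
      liminf (fun ε : ℝ ↦ volume (C ∩ (parallelBody A ε \ A)) / ENNReal.ofReal ε)
        (𝓝[>] (0 : ℝ)) := by
    intro A hA
    rw [← ENNReal.liminf_const_mul_of_ne_top ENNReal.ofReal_ne_top]
    refine liminf_congr (.of_forall fun ε ↦ ?_)
    rw [← mul_div_assoc, ← bodyMeasure_apply hK.2.1 L
      ((isCompact_parallelBody hA ε).measurableSet.diff hA.measurableSet), parallelBody]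
  rw [← hmC]
  apply le_antisymm
  · refine iSup₂_le fun A hA ↦ ?_
    rw [happ A hA.2.1, perimeter_volume_eq]
    refine mul_le_mul_right (liminf_le_liminf ?_) _
    filter_upwards [self_mem_nhdsWithin] with ε hε
    exact ENNReal.div_le_div_right
      (volume_inter_parallelBody_diff_le hA.1 hA.2.1 hCb.2.1 hε) _
  · have hlow : ∀ t ∈ Ioo (0 : ℝ) 1, ENNReal.ofReal (t ^ (n - 1)) *
        (ENNReal.ofReal (L ^ n) * perimeter volume C) ≤ maxPerimeter (bodyMeasure K L) := by
      intro t ht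
      have hb : IsConvexBody (t • C) := hCb.smul ht.1.ne'
      refine le_trans (le_of_eq ?_) (le_iSup₂ (f := fun A (_ : IsConvexBody A) ↦
        perimeter (bodyMeasure K L) A) (t • C) hb)
      rw [happ _ hb.2.1, mul_left_comm, ← perimeter_volume_smul hn C ht.1, perimeter_volume_eq]
      congr 1
      refine liminf_congr ?_
      filter_upwards [eventually_parallelBody_subset hb.2.1
        (smul_subset_interior hCb.1 hC0 ht.1 ht.2)] with ε hε
      rw [inter_eq_self_of_subset_right (sdiff_subset.trans hε)]
    refine le_of_tendsto (tendsto_ofReal_pow_mul (n - 1) (Iio 1) _) ?_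
    filter_upwards [Ioo_mem_nhdsLT (zero_lt_one (α := ℝ))] with t ht using hlow t ht

/-- The ball in K gives K + εB ⊆ (1 + ε/r)K, and n/r is the derivative of (1 + ε/r)ⁿ at 0. -/
theorem perimeter_volume_le_of_closedBall_subset {K : Set 𝔼} (hK : Convex ℝ K)
    (hKc : IsCompact K) {r : ℝ} (hr : 0 < r) (hrK : Metric.closedBall 0 r ⊆ K) :
    perimeter volume K ≤ ENNReal.ofReal (n / r) * volume K := by
  have h0 : (0 : 𝔼) ∈ K := hrK (by simp [hr.le])
  have hfin : volume K ≠ ∞ := hKc.measure_lt_top.ne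
  have hlim : Tendsto (fun ε : ℝ ↦ ENNReal.ofReal (ε⁻¹ * ((1 + ε / r) ^ n - 1)) * volume K) (𝓝[>] 0)
      (𝓝 (ENNReal.ofReal (n / r) * volume K)) := by
    refine ENNReal.Tendsto.mul_const (ENNReal.tendsto_ofReal ?_) (.inr hfin)
    have hd : HasDerivAt (fun ε : ℝ ↦ (1 + ε / r) ^ n) (n / r) 0 := by
      have := (((hasDerivAt_id (0 : ℝ)).div_const r).const_add 1).pow n
      simp only [id_eq, zero_div, add_zero, one_pow, mul_one, mul_one_div] at this
      exact this
    have := (hasDerivAt_iff_tendsto_slope_zero.1 hd).mono_left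
      (nhdsWithin_mono (0 : ℝ) fun x (hx : x ∈ Ioi (0 : ℝ)) ↦ (ne_of_gt hx : x ≠ 0))
    simpa using this
  rw [perimeter_volume_eq, ← hlim.liminf_eq]
  refine liminf_le_liminf ?_
  filter_upwards [self_mem_nhdsWithin] with ε (hε : 0 < ε)
  have hpos : 0 < 1 + ε / r := by positivity
  have hsub : parallelBody K ε ⊆ (1 + ε / r) • K := by
    intro x hx
    obtain ⟨a, ha, hxa⟩ := (mem_parallelBody hε.le).1 hx
    have hb : (r / ε) • (x - a) ∈ K := hrK (by
      rw [mem_closedBall_zero_iff, norm_smul, Real.norm_of_nonneg (by positivity)]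
      calc r / ε * ‖x - a‖ ≤ r / ε * ε := by gcongr
        _ = r := by field_simp)
    -- Weights chosen so that (1 + ε/r) times this combination is a + (x − a) = x.
    have hmem := hK ha hb (a := 1 / (1 + ε / r)) (b := (ε / r) / (1 + ε / r)) (by positivity)
      (by positivity) (by rw [← add_div, div_self hpos.ne'])
    refine ⟨_, hmem, ?_⟩
    simp only [smul_add, smul_smul]
    rw [mul_one_div_cancel hpos.ne', one_smul, ← mul_assoc, mul_div_cancel₀ _ hpos.ne',
      div_mul_div_cancel₀ hr.ne', div_self hε.ne', one_smul, add_sub_cancel]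
  have hKsub : K ⊆ (1 + ε / r) • K := (subset_parallelBody hε.le).trans hsub
  have hv : volume ((1 + ε / r) • K \ K) = ENNReal.ofReal ((1 + ε / r) ^ n - 1) * volume K := by
    rw [measure_sdiff hKsub hKc.measurableSet.nullMeasurableSet hfin,
      Measure.addHaar_smul_of_nonneg _ hpos.le, finrank_euclideanSpace_fin,
      ENNReal.ofReal_sub _ zero_le_one, ENNReal.sub_mul (fun _ _ ↦ hfin), ENNReal.ofReal_one,
      one_mul]
  calc _ ≤ volume ((1 + ε / r) • K \ K) / ENNReal.ofReal ε := by gcongr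
    _ = _ := by
      rw [hv, ENNReal.ofReal_mul (by positivity), ENNReal.ofReal_inv_of_pos hε, div_eq_mul_inv]
      ring

end Scaling

/-! ### Slicing by parallel hyperplanes -/

section Slices

variable {n : ℕ}

local notation "𝔼" => EuclideanSpace ℝ (Fin n)

local notation "σ" => (Measure.euclideanHausdorffMeasure (n - 1) : Measure (EuclideanSpace ℝ (Fin n)))

theorem volume_eq_lintegral_slice {u : 𝔼} (hu : ‖u‖ = 1) {T : Set 𝔼} (hT : MeasurableSet T) :
    volume T = ∫⁻ s : ℝ, σ (T ∩ {y | inner ℝ u y = s}) := by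
  have hu0 : u ≠ 0 := by rintro rfl; simp at hu
  have h := EuclideanGeometry.euclideanHausdorffMeasure_eq_lintegral (0 : 𝔼) hu0 hT
  have he : ‖u‖ₑ = 1 := by rw [← ofReal_norm, hu, ENNReal.ofReal_one]
  rw [he, one_mul, InnerProductSpace.euclideanHausdorffMeasure_eq_volume] at h
  rw [h]
  simp only [finrank_euclideanSpace_fin]
  refine lintegral_congr fun s ↦ ?_
  congr 2
  ext y
  simp only [SetLike.mem_coe, AffineSubspace.mem_mk', mem_ofPred_eq,
    Submodule.mem_orthogonal_singleton_iff_inner_right, vsub_eq_sub, vadd_eq_add, add_zero,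
    inner_sub_right, inner_smul_right, real_inner_self_eq_norm_sq, hu]
  constructor <;> intro h <;> linarith

theorem euclideanHausdorffMeasure_translate_le {F T : Set 𝔼} (v : 𝔼) (h : ∀ y ∈ T, y + v ∈ F)
    (d : ℕ) : Measure.euclideanHausdorffMeasure d T ≤ Measure.euclideanHausdorffMeasure d F :=
  calc _ ≤ Measure.euclideanHausdorffMeasure d ((· + v) ⁻¹' F) := measure_mono h
    _ = _ := measure_preimage_add_right _ _ _

/-- Every slice of W orthogonal to u is translated along u into F, and the nonempty slices occupy an
interval of length ε. -/
theorem volume_slab_le {u : 𝔼} (hu : ‖u‖ = 1) {W F : Set 𝔼} (hW : MeasurableSet W) {a ε h : ℝ}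
    (hWs : ∀ y ∈ W, a ≤ inner ℝ u y ∧ inner ℝ u y ≤ a + ε)
    (hWF : ∀ y ∈ W, y + (h - inner ℝ u y) • u ∈ F) :
    volume W ≤ ENNReal.ofReal ε * σ F := by
  rw [volume_eq_lintegral_slice hu hW]
  calc _ ≤ ∫⁻ s : ℝ, (Icc a (a + ε)).indicator (fun _ ↦ σ F) s := by
        refine lintegral_mono fun s ↦ ?_
        by_cases hs : s ∈ Icc a (a + ε)
        · rw [indicator_of_mem hs]
          refine euclideanHausdorffMeasure_translate_le ((h - s) • u) ?_ _
          rintro y ⟨hy, hys⟩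
          have := hWF y hy
          rwa [show inner ℝ u y = s from hys] at this
        · rw [indicator_of_notMem hs]
          refine le_of_eq (measure_mono_null ?_ measure_empty)
          rintro y ⟨hy, hys⟩
          refine hs ?_
          have := hWs y hy
          rwa [show inner ℝ u y = s from hys] at this
    _ = _ := by
        rw [lintegral_indicator measurableSet_Icc, setLIntegral_const, Real.volume_Icc,
          add_sub_cancel_left, mul_comm]

/-- The prism of height `ε` over the subset `F` of the hyperplane `⟨u, x⟩ = h`. -/
def prism (F : Set 𝔼) (u : 𝔼) (h ε : ℝ) : Set 𝔼 :=
  {y | (h < inner ℝ u y ∧ inner ℝ u y ≤ h + ε) ∧ y + (h - inner ℝ u y) • u ∈ F}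

theorem measurableSet_prism {F : Set 𝔼} (hF : MeasurableSet F) (u : 𝔼) (h ε : ℝ) :
    MeasurableSet (prism F u h ε) := by
  have h1 : MeasurableSet {y : 𝔼 | h < inner ℝ u y} :=
    (isOpen_lt continuous_const (by fun_prop)).measurableSet
  have h2 : MeasurableSet {y : 𝔼 | inner ℝ u y ≤ h + ε} :=
    (isClosed_le (by fun_prop) continuous_const).measurableSet
  have h3 : Measurable fun y : 𝔼 ↦ y + (h - inner ℝ u y) • u :=
    Continuous.measurable (by fun_prop)
  exact (h1.inter h2).inter (h3 hF)

theorem volume_prism {u : 𝔼} (hu : ‖u‖ = 1) {F : Set 𝔼} (hF : MeasurableSet F) {h ε : ℝ}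
    (hFh : ∀ x ∈ F, inner ℝ u x = h) :
    volume (prism F u h ε) = ENNReal.ofReal ε * σ F := by
  refine le_antisymm (volume_slab_le hu (measurableSet_prism hF u h ε) (a := h) (h := h)
    (fun y hy ↦ ⟨hy.1.1.le, hy.1.2⟩) fun y hy ↦ hy.2) ?_
  rw [volume_eq_lintegral_slice hu (measurableSet_prism hF u h ε)]
  calc ENNReal.ofReal ε * σ F = ∫⁻ s : ℝ, (Ioc h (h + ε)).indicator (fun _ ↦ σ F) s := by
        rw [lintegral_indicator measurableSet_Ioc, setLIntegral_const, Real.volume_Ioc,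
          add_sub_cancel_left, mul_comm]
    _ ≤ _ := by
        refine lintegral_mono fun s ↦ ?_
        by_cases hs : s ∈ Ioc h (h + ε)
        · rw [indicator_of_mem hs]
          refine euclideanHausdorffMeasure_translate_le ((s - h) • u) (fun y hy ↦ ?_) _
          have e : inner ℝ u (y + (s - h) • u) = s := by
            rw [inner_add_right, inner_smul_right, real_inner_self_eq_norm_sq, hu, hFh y hy]; ring
          refine ⟨⟨by rw [e]; exact hs, ?_⟩, e⟩
          rw [e, add_assoc, ← add_smul]
          simpa using hy
        · rw [indicator_of_notMem hs]
          exact zero_le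

/-- The prism of height one over F is bounded, and its volume is the measure of F. -/
theorem euclideanHausdorffMeasure_lt_top_of_subset_hyperplane {u : 𝔼} (hu : ‖u‖ = 1) {F : Set 𝔼}
    (hF : IsCompact F) {h : ℝ} (hFh : ∀ x ∈ F, inner ℝ u x = h) : σ F < ∞ := by
  have hv := volume_prism hu hF.measurableSet (ε := 1) hFh
  rw [ENNReal.ofReal_one, one_mul] at hv
  rw [← hv]
  refine lt_of_le_of_lt (measure_mono ?_) (isCompact_parallelBody hF 1).measure_lt_top
  intro y hy
  refine (mem_parallelBody zero_le_one).2 ⟨_, hy.2, ?_⟩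
  rw [sub_add_cancel_left, norm_neg, norm_smul, hu, mul_one, Real.norm_eq_abs, abs_le]
  constructor <;> linarith [hy.1.1, hy.1.2]

/-- All slices parallel to the hyperplane but one are empty. -/
theorem volume_hyperplane {w : 𝔼} (hw : w ≠ 0) (k : ℝ) : volume {y : 𝔼 | inner ℝ w y = k} = 0 := by
  have hu : ‖(‖w‖⁻¹ • w : 𝔼)‖ = 1 := norm_smul_inv_norm hw
  have hm : MeasurableSet {y : 𝔼 | inner ℝ w y = k} :=
    (isClosed_eq (by fun_prop) continuous_const).measurableSet
  rw [volume_eq_lintegral_slice hu hm, lintegral_eq_zero_iff' ?_]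
  · have : ∀ᵐ s : ℝ, s ≠ ‖w‖⁻¹ * k := by simp [ae_iff]
    filter_upwards [this] with s hs
    refine measure_mono_null ?_ measure_empty
    rintro y ⟨hy, hys⟩
    refine hs ?_
    rw [← show inner ℝ w y = k from hy, ← show inner ℝ (‖w‖⁻¹ • w) y = s from hys,
      inner_smul_left]
    simp
  · have : ∀ᵐ s : ℝ, s ≠ ‖w‖⁻¹ * k := by simp [ae_iff]
    refine AEMeasurable.congr (f := fun _ ↦ 0) aemeasurable_const ?_
    filter_upwards [this] with s hs
    refine (measure_mono_null ?_ measure_empty).symm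
    rintro y ⟨hy, hys⟩
    refine hs ?_
    rw [← show inner ℝ w y = k from hy, ← show inner ℝ (‖w‖⁻¹ • w) y = s from hys,
      inner_smul_left]
    simp

end Slices

/-! ### Perimeter and surface area of polytopes -/

section Polytopes

variable {n : ℕ} {ι : Type*}

local notation "𝔼" => EuclideanSpace ℝ (Fin n)

local notation "σ" => (Measure.euclideanHausdorffMeasure (n - 1) : Measure (EuclideanSpace ℝ (Fin n)))

/-- The intersection of the half-spaces `⟨uᵢ, x⟩ ≤ hᵢ`. -/
def polyhedron (u : ι → 𝔼) (h : ι → ℝ) : Set 𝔼 := {x | ∀ i, inner ℝ (u i) x ≤ h i}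

/-- The section of a polyhedron with the `i`-th bounding hyperplane, where all other constraints
are relaxed by `θ`. -/
def relaxedFacet (u : ι → 𝔼) (h : ι → ℝ) (i : ι) (θ : ℝ) : Set 𝔼 :=
  {x | inner ℝ (u i) x = h i ∧ ∀ j, inner ℝ (u j) x ≤ h j + θ}

theorem convex_polyhedron (u : ι → 𝔼) (h : ι → ℝ) : Convex ℝ (polyhedron u h) := by
  rw [polyhedron, ofPred_forall]
  exact convex_iInter fun i ↦ convex_halfSpace_le (innerSL ℝ (u i)).isLinear _

theorem isClosed_polyhedron (u : ι → 𝔼) (h : ι → ℝ) : IsClosed (polyhedron u h) := by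
  rw [polyhedron, ofPred_forall]
  exact isClosed_iInter fun i ↦ isClosed_le (by fun_prop) continuous_const

theorem relaxedFacet_subset (u : ι → 𝔼) (h : ι → ℝ) (i : ι) (θ : ℝ) :
    relaxedFacet u h i θ ⊆ polyhedron u (fun j ↦ h j + θ) := fun _ hx ↦ hx.2

theorem relaxedFacet_zero_subset (u : ι → 𝔼) (h : ι → ℝ) (i : ι) :
    relaxedFacet u h i 0 ⊆ polyhedron u h := fun _ hx j ↦ by simpa using hx.2 j

theorem isClosed_relaxedFacet (u : ι → 𝔼) (h : ι → ℝ) (i : ι) (θ : ℝ) :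
    IsClosed (relaxedFacet u h i θ) :=
  (isClosed_eq (by fun_prop) continuous_const).inter (isClosed_polyhedron u fun j ↦ h j + θ)

theorem smul_polyhedron (u : ι → 𝔼) (h : ι → ℝ) {c : ℝ} (hc : 0 < c) :
    c • polyhedron u h = polyhedron u (fun i ↦ c * h i) := by
  ext x
  rw [mem_smul_set_iff_inv_smul_mem₀ hc.ne']
  refine forall_congr' fun i ↦ ?_
  rw [inner_smul_right, inv_mul_le_iff₀ hc]

theorem isCompact_polyhedron {u : ι → 𝔼} {h : ι → ℝ}
    (hb : Bornology.IsBounded (polyhedron u h)) : IsCompact (polyhedron u h) :=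
  Metric.isCompact_of_isClosed_isBounded (isClosed_polyhedron _ _) hb

/-- Moving a point by at most ε along `u i` changes each other constraint by at most ε, since the
normals are unit vectors; together with the relaxation already present this gives 2ε. -/
theorem volume_facet_slab_le {u : ι → 𝔼} {h : ι → ℝ} (hu : ∀ i, ‖u i‖ = 1) (i : ι) {a ε : ℝ}
    (ha : a ≤ h i) (ha' : h i ≤ a + ε) :
    volume (polyhedron u (fun j ↦ h j + ε) ∩
      {x | a ≤ inner ℝ (u i) x ∧ inner ℝ (u i) x ≤ a + ε}) ≤
        ENNReal.ofReal ε * σ (relaxedFacet u h i (2 * ε)) := by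
  have h1 : IsClosed {x : 𝔼 | a ≤ inner ℝ (u i) x} := isClosed_le continuous_const (by fun_prop)
  have h2 : IsClosed {x : 𝔼 | inner ℝ (u i) x ≤ a + ε} :=
    isClosed_le (by fun_prop) continuous_const
  refine volume_slab_le (hu i) ((isClosed_polyhedron _ _).inter (h1.inter h2)).measurableSet
    (a := a) (h := h i) (fun y hy ↦ hy.2) ?_
  rintro y ⟨hy, h1, h2⟩
  rw [mem_ofPred_eq] at h1 h2
  refine ⟨?_, fun j ↦ ?_⟩
  · rw [inner_add_right, inner_smul_right, real_inner_self_eq_norm_sq, hu i]; ring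
  · rw [inner_add_right, inner_smul_right]
    have hc := abs_real_inner_le_norm (u j) (u i)
    rw [hu, hu, one_mul] at hc
    have : (h i - inner ℝ (u i) y) * inner ℝ (u j) (u i) ≤ ε := by
      refine (le_abs_self _).trans ?_
      rw [abs_mul]
      have : |h i - inner ℝ (u i) y| ≤ ε := abs_le.2 ⟨by linarith, by linarith⟩
      calc _ ≤ ε * 1 := mul_le_mul this hc (abs_nonneg _) ((abs_nonneg _).trans this)
        _ = ε := mul_one ε
    linarith [hy j]

variable [Fintype ι]

theorem isCompact_relaxed_polyhedron {u : ι → 𝔼} {h : ι → ℝ} (hh : ∀ i, 0 < h i)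
    (hb : Bornology.IsBounded (polyhedron u h)) {θ : ℝ} (hθ : 0 ≤ θ) :
    IsCompact (polyhedron u fun i ↦ h i + θ) := by
  refine Metric.isCompact_of_isClosed_isBounded (isClosed_polyhedron _ _) ?_
  -- The sum dominates each θ / h i, so c * h i ≥ h i + θ and the relaxed polyhedron lies in the
  -- c-fold dilate.
  set c := 1 + ∑ j, θ / h j with hc
  have hsum : ∀ i, θ / h i ≤ ∑ j, θ / h j := fun i ↦
    Finset.single_le_sum (f := fun j ↦ θ / h j) (fun j _ ↦ div_nonneg hθ (hh j).le)
      (Finset.mem_univ i)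
  have hc1 : 0 < c := by
    have : 0 ≤ ∑ j, θ / h j := Finset.sum_nonneg fun j _ ↦ div_nonneg hθ (hh j).le
    linarith
  refine (hb.smul₀ c).subset ?_
  rw [smul_polyhedron u h hc1]
  intro x hx i
  refine (hx i).trans ?_
  have := (div_le_iff₀ (hh i)).1 (hsum i)
  change h i + θ ≤ c * h i
  rw [hc, add_mul, one_mul]
  linarith

/-- Continuity from above of a measure that is finite on one of the decreasing sets, because a
relaxed facet is a compact subset of a hyperplane. -/
theorem tendsto_relaxedFacet {u : ι → 𝔼} {h : ι → ℝ} (hu : ∀ i, ‖u i‖ = 1) (hh : ∀ i, 0 < h i)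
    (hb : Bornology.IsBounded (polyhedron u h)) (i : ι) :
    Tendsto (fun θ ↦ σ (relaxedFacet u h i (2 * θ))) (𝓝[>] 0) (𝓝 (σ (relaxedFacet u h i 0))) := by
  have hinter : ⋂ θ > (0 : ℝ), relaxedFacet u h i (2 * θ) = relaxedFacet u h i 0 := by
    ext x
    simp only [mem_iInter]
    refine ⟨fun hx ↦ ⟨(hx 1 one_pos).1, fun j ↦ ?_⟩, fun hx θ hθ ↦ ⟨hx.1, fun j ↦ ?_⟩⟩
    · refine le_of_forall_pos_le_add fun θ hθ ↦ ?_
      have := (hx (θ / 2) (by simpa using hθ)).2 j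
      linarith
    · have := hx.2 j
      linarith [show θ > 0 from hθ]
  rw [← hinter]
  refine tendsto_measure_biInter_gt
    (fun θ _ ↦ (isClosed_relaxedFacet u h i _).measurableSet.nullMeasurableSet)
    (fun a b _ hab x hx ↦ ⟨hx.1, fun j ↦ (hx.2 j).trans (by linarith)⟩)
    ⟨1, one_pos, (euclideanHausdorffMeasure_lt_top_of_subset_hyperplane (hu i) ?_
      fun x hx ↦ hx.1).ne⟩
  exact (isCompact_relaxed_polyhedron hh hb (by norm_num)).of_isClosed_subset
    (isClosed_relaxedFacet _ _ _ _) (relaxedFacet_subset _ _ _ _)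

/-- A collar point violates some constraint, by at most ε, so the collar is covered by slabs of
width ε at the facets. -/
theorem perimeter_polyhedron_le {u : ι → 𝔼} {h : ι → ℝ} (hu : ∀ i, ‖u i‖ = 1) (hh : ∀ i, 0 < h i)
    (hb : Bornology.IsBounded (polyhedron u h)) :
    perimeter volume (polyhedron u h) ≤ ∑ i, σ (relaxedFacet u h i 0) := by
  have hlim : Tendsto (fun ε : ℝ ↦ ∑ i, σ (relaxedFacet u h i (2 * ε))) (𝓝[>] 0)
      (𝓝 (∑ i, σ (relaxedFacet u h i 0))) :=
    tendsto_finsetSum _ fun i _ ↦ tendsto_relaxedFacet hu hh hb i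
  rw [perimeter_volume_eq, ← hlim.liminf_eq]
  refine liminf_le_liminf ?_
  filter_upwards [self_mem_nhdsWithin] with ε (hε : 0 < ε)
  refine ENNReal.div_le_of_le_mul ?_
  rw [Finset.sum_mul]
  have hsub : parallelBody (polyhedron u h) ε \ polyhedron u h ⊆
      ⋃ i, polyhedron u (fun j ↦ h j + ε) ∩
        {x | h i ≤ inner ℝ (u i) x ∧ inner ℝ (u i) x ≤ h i + ε} := by
    rintro x ⟨hx, hxn⟩
    obtain ⟨a, ha, hxa⟩ := (mem_parallelBody hε.le).1 hx
    have hall : ∀ j, inner ℝ (u j) x ≤ h j + ε := fun j ↦ by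
      have h1 := real_inner_le_norm (u j) (x - a)
      rw [hu, one_mul, inner_sub_right] at h1
      linarith [ha j]
    simp only [polyhedron, mem_ofPred_eq, not_forall, not_le] at hxn
    obtain ⟨i, hi⟩ := hxn
    exact mem_iUnion.2 ⟨i, hall, hi.le, hall i⟩
  refine (measure_mono hsub).trans ((measure_iUnion_fintype_le _ _).trans
    (Finset.sum_le_sum fun i _ ↦ ?_))
  rw [mul_comm]
  exact volume_facet_slab_le hu i le_rfl (by linarith)

/-- The prisms over the facets lie in the collar. They are disjoint because the metric projection of
a prism point y is its foot on the facet, so the direction of y − P y determines the normal and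
hence the facet. -/
theorem sum_facets_le_perimeter {u : ι → 𝔼} {h : ι → ℝ} (hu : ∀ i, ‖u i‖ = 1)
    (hinj : Function.Injective u) (hne : (polyhedron u h).Nonempty) :
    ∑ i, σ (relaxedFacet u h i 0) ≤ perimeter volume (polyhedron u h) := by
  obtain ⟨P, hP⟩ := exists_isMetricProj (convex_polyhedron u h) (isClosed_polyhedron u h) hne
  rw [perimeter_volume_eq]
  refine le_liminf_of_le (by isBoundedDefault) ?_
  filter_upwards [self_mem_nhdsWithin] with ε (hε : 0 < ε)
  rw [ENNReal.le_div_iff_mul_le (.inl (by simpa using hε)) (.inl ENNReal.ofReal_ne_top),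
    Finset.sum_mul]
  have hmF : ∀ i, MeasurableSet (relaxedFacet u h i 0) := fun i ↦
    (isClosed_relaxedFacet u h i 0).measurableSet
  have hproj : ∀ i, ∀ y ∈ prism (relaxedFacet u h i 0) (u i) (h i) ε,
      P y = y + (h i - inner ℝ (u i) y) • u i := by
    intro i y hy
    refine hP.eq_of_inner_le (relaxedFacet_zero_subset u h i hy.2) fun a ha ↦ ?_
    have e1 := hy.2.1
    rw [sub_add_cancel_left, ← neg_smul, inner_smul_left, inner_sub_right, e1]
    exact mul_nonpos_of_nonneg_of_nonpos (by simpa using hy.1.1.le) (by linarith [ha i])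
  have hdisj : Pairwise (Function.onFun Disjoint
      fun i ↦ prism (relaxedFacet u h i 0) (u i) (h i) ε) := by
    intro i j hij
    rw [Function.onFun, Set.disjoint_left]
    intro y hi hj
    refine hij (hinj ?_)
    have e := (hproj i y hi).symm.trans (hproj j y hj)
    have e2 : (inner ℝ (u i) y - h i) • u i = (inner ℝ (u j) y - h j) • u j := by
      rw [← neg_sub (h i), ← neg_sub (h j), neg_smul, neg_smul, add_left_cancel e]
    have hi0 : 0 < inner ℝ (u i) y - h i := by linarith [hi.1.1]
    have hj0 : 0 < inner ℝ (u j) y - h j := by linarith [hj.1.1]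
    have e3 := congrArg norm e2
    rw [norm_smul, norm_smul, hu, hu, mul_one, mul_one, Real.norm_of_nonneg hi0.le,
      Real.norm_of_nonneg hj0.le] at e3
    rw [← e3] at e2
    exact (smul_right_injective _ hi0.ne') e2
  calc _ = ∑ i, volume (prism (relaxedFacet u h i 0) (u i) (h i) ε) := by
        refine Finset.sum_congr rfl fun i _ ↦ ?_
        rw [volume_prism (hu i) (hmF i) fun x hx ↦ hx.1, mul_comm]
    _ = volume (⋃ i, prism (relaxedFacet u h i 0) (u i) (h i) ε) := by
        rw [measure_iUnion hdisj fun i ↦ measurableSet_prism (hmF i) _ _ _, tsum_fintype]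
    _ ≤ _ := by
        refine measure_mono (iUnion_subset fun i y hy ↦ ⟨?_, fun hyQ ↦ ?_⟩)
        · refine (mem_parallelBody hε.le).2 ⟨_, relaxedFacet_zero_subset u h i hy.2, ?_⟩
          rw [sub_add_cancel_left, norm_neg, norm_smul, hu, mul_one, Real.norm_eq_abs, abs_le]
          constructor <;> linarith [hy.1.1, hy.1.2]
        · exact absurd (hyQ i) (not_le.2 hy.1.1)

theorem frontier_polyhedron {u : ι → 𝔼} {h : ι → ℝ} (hu : ∀ i, ‖u i‖ = 1) :
    frontier (polyhedron u h) = ⋃ i, relaxedFacet u h i 0 := by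
  rw [(isClosed_polyhedron u h).frontier_eq]
  ext x
  simp only [mem_iUnion]
  constructor
  · rintro ⟨hx, hxi⟩
    by_contra! hcon
    refine hxi (mem_interior_iff_mem_nhds.2 ?_)
    have : ∀ i, ∀ᶠ y in 𝓝 x, inner ℝ (u i) y < h i := fun i ↦ by
      have hlt : inner ℝ (u i) x < h i := lt_of_le_of_ne (hx i) fun he ↦
        hcon i ⟨he, fun j ↦ by simpa using hx j⟩
      exact (isOpen_lt (by fun_prop) continuous_const).mem_nhds hlt
    filter_upwards [eventually_all.2 this] with y hy i using (hy i).le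
  · rintro ⟨i, hi⟩
    refine ⟨relaxedFacet_zero_subset u h i hi, fun hin ↦ ?_⟩
    have hc : Continuous fun t : ℝ ↦ x + t • u i := by fun_prop
    have h0 : Tendsto (fun t : ℝ ↦ x + t • u i) (𝓝 0) (𝓝 x) := by simpa using hc.tendsto 0
    obtain ⟨t, ht, htpos⟩ := (((h0.eventually (mem_interior_iff_mem_nhds.1 hin)).filter_mono
      nhdsWithin_le_nhds).and (self_mem_nhdsWithin : Ioi (0 : ℝ) ∈ 𝓝[>] 0)).exists
    have := ht i
    rw [inner_add_right, inner_smul_right, real_inner_self_eq_norm_sq, hu, hi.1] at this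
    linarith [show (0 : ℝ) < t from htpos]

/-- Two facets meet in a null set: the unit prism over the intersection lies in a hyperplane with
normal `u j - c • u i`. If this vector vanishes then u j = ±u i; the sign + contradicts injectivity,
and − would give h j = −h i, against positivity. -/
theorem surfaceArea_polyhedron {u : ι → 𝔼} {h : ι → ℝ} (hu : ∀ i, ‖u i‖ = 1)
    (hinj : Function.Injective u) (hh : ∀ i, 0 < h i) :
    surfaceArea (polyhedron u h) = ∑ i, σ (relaxedFacet u h i 0) := by
  have hmF : ∀ i, MeasurableSet (relaxedFacet u h i 0) := fun i ↦
    (isClosed_relaxedFacet u h i 0).measurableSet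
  rw [surfaceArea, frontier_polyhedron hu, measure_iUnion₀ ?_ fun i ↦ (hmF i).nullMeasurableSet,
    tsum_fintype]
  intro i j hij
  have hmI := (hmF i).inter (hmF j)
  have hv := volume_prism (hu i) hmI (h := h i) (ε := 1) fun x hx ↦ hx.1.1
  rw [ENNReal.ofReal_one, one_mul] at hv
  refine hv.symm.trans ?_
  set c := inner ℝ (u i) (u j) with hc
  rcases eq_or_ne (u j - c • u i) 0 with hw | hw
  · rw [sub_eq_zero] at hw
    have hc1 : |c| = 1 := by
      have := congrArg norm hw
      rwa [norm_smul, hu, hu, mul_one, Real.norm_eq_abs, eq_comm] at this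
    refine measure_mono_null ?_ measure_empty
    rintro y ⟨-, hyi, hyj⟩
    have h1 := hyi.1
    have h2 := hyj.1
    rw [hw, inner_smul_left, h1] at h2
    simp only [conj_trivial] at h2
    rcases (abs_eq zero_le_one).1 hc1 with h3 | h3
    · exact hij (hinj (by rw [hw, h3, one_smul]))
    · rw [h3] at h2
      linarith [hh i, hh j]
  · refine measure_mono_null ?_ (volume_hyperplane hw (h j - c * h i))
    rintro y ⟨-, hyi, hyj⟩
    have h2 := hyj.1
    rw [inner_add_right, inner_smul_right, real_inner_comm (u i) (u j), ← hc] at h2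
    simp only [mem_ofPred_eq, inner_sub_left, inner_smul_left, conj_trivial]
    linarith

theorem perimeter_polyhedron {u : ι → 𝔼} {h : ι → ℝ} (hu : ∀ i, ‖u i‖ = 1)
    (hinj : Function.Injective u) (hh : ∀ i, 0 < h i)
    (hb : Bornology.IsBounded (polyhedron u h)) :
    perimeter volume (polyhedron u h) = surfaceArea (polyhedron u h) := by
  rw [surfaceArea_polyhedron hu hinj hh]
  exact le_antisymm (perimeter_polyhedron_le hu hh hb)
    (sum_facets_le_perimeter hu hinj ⟨0, fun i ↦ by simpa using (hh i).le⟩)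

/-- A polytope circumscribed about a ball of radius `ρ` has perimeter at least `n / ρ` times its
volume. -/
theorem le_perimeter_of_circumscribed {u : ι → 𝔼} {ρ : ℝ} (hu : ∀ i, ‖u i‖ = 1)
    (hinj : Function.Injective u) (hρ : 0 < ρ)
    (hb : Bornology.IsBounded (polyhedron u fun _ ↦ ρ)) :
    ENNReal.ofReal (n / ρ) * volume (polyhedron u fun _ ↦ ρ) ≤
      perimeter volume (polyhedron u fun _ ↦ ρ) := by
  refine le_trans ?_ (sum_facets_le_perimeter hu hinj ⟨0, fun i ↦ by simpa using hρ.le⟩)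
  set Q := polyhedron u fun _ ↦ ρ with hQ
  have hQc : IsCompact Q := isCompact_polyhedron hb
  have hfin : volume Q ≠ ∞ := hQc.measure_lt_top.ne
  have hlim : Tendsto (fun ε : ℝ ↦ ∑ i, σ (relaxedFacet u (fun _ ↦ ρ) i (2 * ε))) (𝓝[>] 0)
      (𝓝 (∑ i, σ (relaxedFacet u (fun _ ↦ ρ) i 0))) :=
    tendsto_finsetSum _ fun i _ ↦ tendsto_relaxedFacet hu (fun _ ↦ hρ) hb i
  have hlim2 : Tendsto (fun ε : ℝ ↦ ENNReal.ofReal (ε⁻¹ * (1 - (1 - ε / ρ) ^ n)) * volume Q) (𝓝[>] 0)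
      (𝓝 (ENNReal.ofReal (n / ρ) * volume Q)) := by
    refine ENNReal.Tendsto.mul_const (ENNReal.tendsto_ofReal ?_) (.inr hfin)
    have hd : HasDerivAt (fun ε : ℝ ↦ -(1 - ε / ρ) ^ n) (n / ρ) 0 := by
      have := ((((hasDerivAt_id (0 : ℝ)).div_const ρ).const_sub 1).pow n).neg
      simp only [id_eq, zero_div, sub_zero, one_pow, mul_one, mul_neg, neg_neg, mul_one_div] at this
      exact this
    have := (hasDerivAt_iff_tendsto_slope_zero.1 hd).mono_left
      (nhdsWithin_mono (0 : ℝ) fun x (hx : x ∈ Ioi (0 : ℝ)) ↦ (ne_of_gt hx : x ≠ 0))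
    refine this.congr fun ε ↦ ?_
    simp only [zero_add, zero_div, sub_zero, one_pow, smul_eq_mul]
    ring
  refine le_of_tendsto_of_tendsto hlim2 hlim ?_
  filter_upwards [Ioo_mem_nhdsGT hρ] with ε hε
  have hpos : 0 < 1 - ε / ρ := by
    rw [sub_pos, div_lt_one hρ]; exact hε.2
  have hle1 : 1 - ε / ρ ≤ 1 := by
    have := div_nonneg hε.1.le hρ.le
    linarith
  -- As all heights equal ρ, this dilation moves each facet inward by exactly ε, so the shell
  -- between the two polytopes is covered by slabs of width ε.
  have hsm : (1 - ε / ρ) • Q = polyhedron u fun _ ↦ ρ - ε := by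
    rw [hQ, smul_polyhedron _ _ hpos]
    congr 1
    funext _
    field_simp
  have hsub : (1 - ε / ρ) • Q ⊆ Q := by
    rw [hsm]
    exact fun x hx i ↦ (hx i).trans (by linarith [hε.1])
  have hv : volume (Q \ (1 - ε / ρ) • Q) =
      ENNReal.ofReal (1 - (1 - ε / ρ) ^ n) * volume Q := by
    have hfin2 : volume ((1 - ε / ρ) • Q) ≠ ∞ := (hQc.smul (1 - ε / ρ)).measure_lt_top.ne
    rw [measure_sdiff hsub (hQc.smul _).measurableSet.nullMeasurableSet hfin2,
      Measure.addHaar_smul_of_nonneg _ hpos.le, finrank_euclideanSpace_fin,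
      ENNReal.ofReal_sub _ (by positivity), ENNReal.sub_mul (fun _ _ ↦ hfin), ENNReal.ofReal_one,
      one_mul]
  have hcov : Q \ (1 - ε / ρ) • Q ⊆ ⋃ i, polyhedron u (fun _ ↦ ρ + ε) ∩
      {x | ρ - ε ≤ inner ℝ (u i) x ∧ inner ℝ (u i) x ≤ ρ - ε + ε} := by
    rintro x ⟨hx, hxn⟩
    rw [hsm] at hxn
    simp only [polyhedron, mem_ofPred_eq, not_forall, not_le] at hxn
    obtain ⟨i, hi⟩ := hxn
    exact mem_iUnion.2 ⟨i, fun j ↦ (hx j).trans (by linarith [hε.1]), hi.le,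
      (hx i).trans (by linarith)⟩
  have hmain : ENNReal.ofReal (1 - (1 - ε / ρ) ^ n) * volume Q ≤
      ∑ i, ENNReal.ofReal ε * σ (relaxedFacet u (fun _ ↦ ρ) i (2 * ε)) := by
    rw [← hv]
    exact (measure_mono hcov).trans ((measure_iUnion_fintype_le _ _).trans
      (Finset.sum_le_sum fun i _ ↦ volume_facet_slab_le hu i (by linarith [hε.1])
        (by linarith)))
  rw [← Finset.mul_sum] at hmain
  rw [ENNReal.ofReal_mul (inv_nonneg.2 hε.1.le), ENNReal.ofReal_inv_of_pos hε.1, mul_assoc]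
  calc _ ≤ (ENNReal.ofReal ε)⁻¹ * (ENNReal.ofReal ε *
        ∑ i, σ (relaxedFacet u (fun _ ↦ ρ) i (2 * ε))) := mul_le_mul_right hmain _
    _ = _ := by
      rw [← mul_assoc, ENNReal.inv_mul_cancel (by simpa using hε.1) ENNReal.ofReal_ne_top, one_mul]

end Polytopes

/-! ### Approximation by polytopes: content equals surface area -/

section Approximation

variable {n : ℕ}

local notation "𝔼" => EuclideanSpace ℝ (Fin n)

/-- The support function of a set. -/
noncomputable def supportFun (K : Set 𝔼) (u : 𝔼) : ℝ := sSup ((fun x ↦ inner ℝ u x) '' K)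

theorem inner_le_supportFun {K : Set 𝔼} (hK : IsCompact K) (u : 𝔼) {x : 𝔼} (hx : x ∈ K) :
    inner ℝ u x ≤ supportFun K u :=
  le_csSup (hK.image (by fun_prop)).bddAbove ⟨x, hx, rfl⟩

theorem supportFun_le {K : Set 𝔼} (hK : K.Nonempty) {u : 𝔼} {c : ℝ}
    (h : ∀ x ∈ K, inner ℝ u x ≤ c) : supportFun K u ≤ c :=
  csSup_le (hK.image _) (by rintro _ ⟨x, hx, rfl⟩; exact h x hx)

theorem supportFun_pos {K : Set 𝔼} (hK : IsCompact K) (h0 : (0 : 𝔼) ∈ interior K) {u : 𝔼}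
    (hu : ‖u‖ = 1) : 0 < supportFun K u := by
  obtain ⟨r, hr, hrK⟩ := Metric.nhds_basis_closedBall.mem_iff.1 (mem_interior_iff_mem_nhds.1 h0)
  have := inner_le_supportFun hK u (hrK (by
    rw [mem_closedBall_zero_iff, norm_smul, hu, mul_one, Real.norm_of_nonneg hr.le] :
      r • u ∈ Metric.closedBall 0 r))
  rw [inner_smul_right, real_inner_self_eq_norm_sq, hu] at this
  linarith

theorem exists_supportFun_lt {K : Set 𝔼} (hK : Convex ℝ K) (hc : IsCompact K) (hne : K.Nonempty)
    {y : 𝔼} (hy : y ∉ K) : ∃ u : 𝔼, ‖u‖ = 1 ∧ supportFun K u < inner ℝ u y := by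
  obtain ⟨f, c, hfK, hfy⟩ := geometric_hahn_banach_closed_point hK hc.isClosed hy
  obtain ⟨v, rfl⟩ := (InnerProductSpace.toDual ℝ 𝔼).surjective f
  simp only [InnerProductSpace.toDual_apply_apply] at hfK hfy
  have hv : v ≠ 0 := by
    rintro rfl
    obtain ⟨a, ha⟩ := hne
    have := hfK a ha
    simp only [inner_zero_left] at this hfy
    linarith
  have hpos : 0 < ‖v‖⁻¹ := inv_pos.2 (norm_pos_iff.2 hv)
  refine ⟨‖v‖⁻¹ • v, norm_smul_inv_norm hv, ?_⟩
  have h1 : supportFun K (‖v‖⁻¹ • v) ≤ ‖v‖⁻¹ * c := supportFun_le hne fun x hx ↦ by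
    rw [inner_smul_left]
    exact mul_le_mul_of_nonneg_left (hfK x hx).le hpos.le
  refine h1.trans_lt ?_
  rw [inner_smul_left]
  exact mul_lt_mul_of_pos_left hfy hpos

/-- Supporting half-spaces of K cut off every point of the compact frontier of tK, and finitely many
suffice. The resulting polyhedron is connected, misses that frontier and contains 0, so it stays
inside tK. -/
theorem exists_polyhedron_between {K : Set 𝔼} (hK : Convex ℝ K) (hc : IsCompact K)
    (h0 : (0 : 𝔼) ∈ interior K) {t : ℝ} (ht : 1 < t) :
    ∃ T : Finset {u : 𝔼 // ‖u‖ = 1},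
      K ⊆ polyhedron (fun i : T ↦ i.1.1) (fun i : T ↦ supportFun K i.1.1) ∧
        polyhedron (fun i : T ↦ i.1.1) (fun i : T ↦ supportFun K i.1.1) ⊆ t • K := by
  have hK0 : (0 : 𝔼) ∈ K := interior_subset h0
  have htK : IsCompact (t • K) := hc.smul t
  have hKt := subset_interior_smul hK h0 ht
  obtain ⟨T, hT⟩ := (htK.of_isClosed_subset isClosed_frontier
    htK.isClosed.frontier_subset).elim_finite_subcover
    (fun u : {u : 𝔼 // ‖u‖ = 1} ↦ {y | supportFun K u.1 < inner ℝ u.1 y})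
    (fun u ↦ isOpen_lt continuous_const (by fun_prop)) (by
      intro y hy
      rw [htK.isClosed.frontier_eq] at hy
      obtain ⟨u, hu, h⟩ := exists_supportFun_lt hK hc ⟨0, hK0⟩ (fun hyK ↦ hy.2 (hKt hyK))
      exact mem_iUnion.2 ⟨⟨u, hu⟩, h⟩)
  have hsub : K ⊆ polyhedron (fun i : T ↦ i.1.1) (fun i : T ↦ supportFun K i.1.1) :=
    fun x hx i ↦ inner_le_supportFun hc _ hx
  refine ⟨T, hsub, fun x hx ↦ ?_⟩
  by_contra hxn
  have hfr : ∀ y ∈ polyhedron (fun i : T ↦ i.1.1) (fun i : T ↦ supportFun K i.1.1),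
      y ∉ frontier (t • K) := fun y hyQ hy ↦ by
    obtain ⟨u, hu, hlt⟩ := mem_iUnion₂.1 (hT hy)
    exact absurd (hyQ ⟨u, hu⟩) (not_le.2 hlt)
  obtain ⟨y, -, hy, hyn⟩ := (convex_polyhedron (fun i : T ↦ i.1.1)
    (fun i : T ↦ supportFun K i.1.1)).isPreconnected (interior (t • K)) (t • K)ᶜ isOpen_interior
    htK.isClosed.isOpen_compl (fun y hy ↦ by
      by_cases hyt : y ∈ t • K
      · have := hfr y hy
        rw [htK.isClosed.frontier_eq] at this
        exact .inl (by_contra fun h ↦ this ⟨hyt, h⟩)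
      · exact .inr hyt) ⟨0, hsub hK0, hKt hK0⟩ ⟨x, hx, hxn⟩
  exact hyn (interior_subset hy)

/-- Dilating B by t > 1 makes the inclusion strict; then t → 1. -/
theorem perimeter_volume_mono_of_subset (hn : 1 ≤ n) {A B : Set 𝔼} (hA : Convex ℝ A)
    (hAc : IsCompact A) (hB : Convex ℝ B) (hBc : IsCompact B) (h0 : (0 : 𝔼) ∈ interior B)
    (hAB : A ⊆ B) : perimeter volume A ≤ perimeter volume B := by
  refine ge_of_tendsto (tendsto_ofReal_pow_mul (n - 1) (Ioi 1) (perimeter volume B)) ?_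
  filter_upwards [self_mem_nhdsWithin] with t (ht : 1 < t)
  rw [← perimeter_volume_smul hn B (by linarith)]
  exact perimeter_volume_mono hA hAc (hBc.smul t) (hAB.trans (subset_interior_smul hB h0 ht))

theorem surfaceArea_smul (K : Set 𝔼) {t : ℝ} (ht : 0 < t) :
    surfaceArea (t • K) = ENNReal.ofReal (t ^ (n - 1)) * surfaceArea K :=
  euclideanHausdorffMeasure_frontier_smul (n - 1) K ht

/-- The outer Minkowski content of a convex body is its surface area. -/
theorem perimeter_volume_eq_surfaceArea (hn : 1 ≤ n) {K : Set 𝔼} (hK : IsConvexBody K)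
    (h0 : (0 : 𝔼) ∈ interior K) : perimeter volume K = surfaceArea K := by
  -- With K ⊆ Q ⊆ tK and Q a polytope, where both quantities agree, monotonicity and homogeneity
  -- compare them on K up to a factor t^(n-1).
  have key : ∀ t : ℝ, 1 < t →
      perimeter volume K ≤ ENNReal.ofReal (t ^ (n - 1)) * surfaceArea K ∧
      surfaceArea K ≤ ENNReal.ofReal (t ^ (n - 1)) * perimeter volume K := by
    intro t ht
    have ht0 : 0 < t := by linarith
    obtain ⟨T, hKQ, hQK⟩ := exists_polyhedron_between hK.1 hK.2.1 h0 ht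
    set Q := polyhedron (fun i : T ↦ i.1.1) (fun i : T ↦ supportFun K i.1.1)
    have htK := hK.smul ht0.ne'
    have hb : Bornology.IsBounded Q := htK.2.1.isBounded.subset hQK
    have hQc : IsCompact Q := isCompact_polyhedron hb
    have h0Q : (0 : 𝔼) ∈ interior Q := interior_mono hKQ h0
    have hQb : IsConvexBody Q := ⟨convex_polyhedron _ _, hQc, ⟨0, h0Q⟩⟩
    have hQeq : perimeter volume Q = surfaceArea Q :=
      perimeter_polyhedron (fun i ↦ i.1.2)
        (Subtype.val_injective.comp Subtype.val_injective)
        (fun i ↦ supportFun_pos hK.2.1 h0 i.1.2) hb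
    constructor
    · rw [← surfaceArea_smul K ht0]
      exact (perimeter_volume_mono_of_subset hn hK.1 hK.2.1 hQb.1 hQc h0Q hKQ).trans
        (hQeq.le.trans (euclideanHausdorffMeasure_frontier_mono hQb htK.2.1 hQK _))
    · rw [← perimeter_volume_smul hn K ht0]
      refine (euclideanHausdorffMeasure_frontier_mono hK hQc hKQ _).trans (hQeq.ge.trans ?_)
      exact perimeter_volume_mono_of_subset hn hQb.1 hQc htK.1 htK.2.1
        (subset_interior_smul hK.1 h0 ht (interior_subset h0)) hQK
  apply le_antisymm
  · refine ge_of_tendsto (tendsto_ofReal_pow_mul (n - 1) (Ioi 1) _) ?_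
    filter_upwards [self_mem_nhdsWithin] with t ht using (key t ht).1
  · refine ge_of_tendsto (tendsto_ofReal_pow_mul (n - 1) (Ioi 1) _) ?_
    filter_upwards [self_mem_nhdsWithin] with t ht using (key t ht).2

end Approximation

/-! ### Prékopa–Leindler and Brunn–Minkowski -/

section BrunnMinkowski

theorem measure_eq_iSup_compact_subtype {A : Set ℝ} (hA : MeasurableSet A) :
    volume A = ⨆ K : {K : Set ℝ // K ⊆ A ∧ IsCompact K}, volume K.1 := by
  rw [hA.measure_eq_iSup_isCompact]
  apply le_antisymm
  · exact iSup_le fun K ↦ iSup_le fun h1 ↦ iSup_le fun h2 ↦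
      le_iSup (fun K : {K : Set ℝ // K ⊆ A ∧ IsCompact K} ↦ volume K.1) ⟨K, h1, h2⟩
  · exact iSup_le fun K ↦ le_iSup_of_le K.1 (le_iSup_of_le K.2.1 (le_iSup_of_le K.2.2 le_rfl))

theorem volume_affine_image (c d : ℝ) (hc : 0 ≤ c) (A : Set ℝ) :
    volume ((fun x ↦ c * x + d) '' A) = ENNReal.ofReal c * volume A := by
  have : (fun x ↦ c * x + d) '' A = (· + d) '' (c • A) := by
    rw [← image_smul, image_image]; rfl
  rw [this, image_add_right, measure_preimage_add_right, Measure.addHaar_smul_of_nonneg _ hc]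
  simp

/-- The one-dimensional Brunn–Minkowski inequality. -/
theorem brunnMinkowski_real {A B C : Set ℝ} (hA : MeasurableSet A) (hB : MeasurableSet B)
    (hAne : A.Nonempty) (hBne : B.Nonempty) {l : ℝ} (hl0 : 0 ≤ l) (hl1 : l ≤ 1)
    (h : ∀ x ∈ A, ∀ y ∈ B, (1 - l) * x + l * y ∈ C) :
    ENNReal.ofReal (1 - l) * volume A + ENNReal.ofReal l * volume B ≤ volume C := by
  have key : ∀ S T : Set ℝ, S ⊆ A → IsCompact S → S.Nonempty → T ⊆ B → IsCompact T → T.Nonempty →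
      ENNReal.ofReal (1 - l) * volume S + ENNReal.ofReal l * volume T ≤ volume C := by
    intro S T hSA hS hSne hTB hT hTne
    obtain ⟨a, ha, hamax⟩ := hS.exists_isGreatest hSne
    obtain ⟨b, hb, hbmin⟩ := hT.exists_isLeast hTne
    -- C contains (1 − l)S + l min T and (1 − l) max S + lT, which meet at most in the point (1 − l)
    -- max S + l min T.
    rw [← volume_affine_image (1 - l) (l * b) (by linarith) S,
      ← volume_affine_image l ((1 - l) * a) hl0 T]
    have hTm : MeasurableSet ((fun x ↦ l * x + (1 - l) * a) '' T) :=
      (hT.image (by fun_prop)).measurableSet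
    rw [← measure_union₀ hTm.nullMeasurableSet]
    · refine measure_mono (union_subset ?_ ?_)
      · rintro _ ⟨x, hx, rfl⟩
        exact h x (hSA hx) b (hTB hb)
      · rintro _ ⟨y, hy, rfl⟩
        have := h a (hSA ha) y (hTB hy)
        rwa [add_comm] at this
    · refine measure_mono_null (t := {(1 - l) * a + l * b}) ?_ (by simp)
      rintro _ ⟨⟨x, hx, rfl⟩, y, hy, hxy⟩
      have h1 : (1 - l) * x ≤ (1 - l) * a :=
        mul_le_mul_of_nonneg_left (hamax hx) (by linarith)
      have h2 : l * b ≤ l * y := mul_le_mul_of_nonneg_left (hbmin hy) hl0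
      simp only at hxy ⊢
      rw [mem_singleton_iff]
      linarith
  obtain ⟨a, ha⟩ := hAne
  obtain ⟨b, hb⟩ := hBne
  rw [measure_eq_iSup_compact_subtype hA, measure_eq_iSup_compact_subtype hB, ENNReal.mul_iSup,
    ENNReal.mul_iSup]
  have : Nonempty {K : Set ℝ // K ⊆ A ∧ IsCompact K} := ⟨⟨∅, by simp, by simp⟩⟩
  have : Nonempty {K : Set ℝ // K ⊆ B ∧ IsCompact K} := ⟨⟨∅, by simp, by simp⟩⟩
  refine ENNReal.iSup_add_iSup_le fun S T ↦ ?_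
  -- Adding a point keeps the inner compact sets nonempty, as `key` requires.
  refine le_trans ?_ (key (insert a S.1) (insert b T.1) (insert_subset ha S.2.1)
    (S.2.2.insert a) (insert_nonempty _ _) (insert_subset hb T.2.1)
    (T.2.2.insert b) (insert_nonempty _ _))
  gcongr <;> exact subset_insert _ _

/-- Layer cake and one-dimensional Brunn–Minkowski on superlevel sets. With both suprema equal to
one, the superlevel sets of f and g are nonempty for t < 1 and empty for t ≥ 1, so the bound holds
at every level. -/
theorem lintegral_ofReal_superlevel {f g h : ℝ → ℝ} (hf : Measurable f) (hg : Measurable g)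
    (hh : Measurable h) (hf0 : ∀ x, 0 ≤ f x) (hg0 : ∀ x, 0 ≤ g x) (hh0 : ∀ x, 0 ≤ h x)
    (hf1 : ∀ x, f x ≤ 1) (hg1 : ∀ x, g x ≤ 1) (hfs : ∀ t < 1, ∃ x, t < f x)
    (hgs : ∀ t < 1, ∃ x, t < g x) {l : ℝ} (hl0 : 0 ≤ l) (hl1 : l ≤ 1)
    (H : ∀ x y t, 0 < t → t < f x → t < g y → t < h ((1 - l) * x + l * y)) :
    ENNReal.ofReal (1 - l) * (∫⁻ x, ENNReal.ofReal (f x)) +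
      ENNReal.ofReal l * (∫⁻ x, ENNReal.ofReal (g x)) ≤ ∫⁻ x, ENNReal.ofReal (h x) := by
  rw [lintegral_eq_lintegral_meas_lt _ (.of_forall hf0) hf.aemeasurable,
    lintegral_eq_lintegral_meas_lt _ (.of_forall hg0) hg.aemeasurable,
    lintegral_eq_lintegral_meas_lt _ (.of_forall hh0) hh.aemeasurable]
  have hanti : ∀ φ : ℝ → ℝ, Measurable fun t : ℝ ↦ volume {a | t < φ a} := fun φ ↦
    Antitone.measurable fun s t hst ↦ measure_mono fun x (hx : t < φ x) ↦ hst.trans_lt hx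
  rw [← lintegral_const_mul _ (hanti f), ← lintegral_const_mul _ (hanti g),
    ← lintegral_add_left ((hanti f).const_mul _)]
  refine setLIntegral_mono (hanti h) fun t (ht : 0 < t) ↦ ?_
  rcases lt_or_ge t 1 with ht1 | ht1
  · exact brunnMinkowski_real (hf measurableSet_Ioi) (hg measurableSet_Ioi) (hfs t ht1) (hgs t ht1)
      hl0 hl1 fun x hx y hy ↦ H x y t ht hx hy
  · have e1 : {a | t < f a} = ∅ := eq_empty_of_forall_notMem fun x (hx : t < f x) ↦
      absurd (hf1 x) (by linarith)
    have e2 : {a | t < g a} = ∅ := eq_empty_of_forall_notMem fun x (hx : t < g x) ↦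
      absurd (hg1 x) (by linarith)
    simp [e1, e2]

theorem ennreal_geom_mean_le (a b : ℝ≥0∞) {l : ℝ} (hl0 : 0 < l) (hl1 : l < 1) :
    a ^ (1 - l) * b ^ l ≤ ENNReal.ofReal (1 - l) * a + ENNReal.ofReal l * b := by
  have h1 : 0 < 1 - l := by linarith
  rcases eq_or_ne a ∞ with rfl | ha
  · rw [ENNReal.mul_top (by simpa using hl1)]; simp
  rcases eq_or_ne b ∞ with rfl | hb
  · rw [ENNReal.mul_top (by simpa using hl0)]; simp
  lift a to NNReal using ha
  lift b to NNReal using hb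
  rw [← ENNReal.coe_rpow_of_nonneg _ h1.le, ← ENNReal.coe_rpow_of_nonneg _ hl0.le,
    ENNReal.ofReal, ENNReal.ofReal]
  norm_cast
  have := NNReal.geom_mean_le_arith_mean2_weighted (Real.toNNReal (1 - l)) (Real.toNNReal l) a b
    (by rw [← Real.toNNReal_add h1.le hl0.le]; simp)
  rwa [Real.coe_toNNReal _ h1.le, Real.coe_toNNReal _ hl0.le] at this

/-- Normalising f and g to supremum one and h by c gives an arithmetic-mean bound on the integrals,
which is stronger than the geometric-mean one. -/
theorem prekopaLeindler_real_of_bounded {f g h : ℝ → ℝ≥0∞} (hf : Measurable f) (hg : Measurable g)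
    (hh : Measurable h) (hfb : ⨆ x, f x ≠ ∞) (hgb : ⨆ x, g x ≠ ∞) {l : ℝ} (hl0 : 0 < l)
    (hl1 : l < 1) (H : ∀ x y, f x ^ (1 - l) * g y ^ l ≤ h ((1 - l) * x + l * y)) :
    (∫⁻ x, f x) ^ (1 - l) * (∫⁻ x, g x) ^ l ≤ ∫⁻ x, h x := by
  have h1l : 0 < 1 - l := by linarith
  set F := ⨆ x, f x with hF
  set G := ⨆ x, g x with hG
  have hfF : ∀ x, f x ≤ F := le_iSup f
  have hgG : ∀ x, g x ≤ G := le_iSup g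
  rcases eq_or_ne F 0 with hF0 | hF0
  · have : ∫⁻ x, f x = 0 := by
      rw [lintegral_congr fun x ↦ le_antisymm ((hfF x).trans hF0.le) zero_le]; simp
    rw [this, ENNReal.zero_rpow_of_pos h1l, zero_mul]
    exact zero_le
  rcases eq_or_ne G 0 with hG0 | hG0
  · have : ∫⁻ x, g x = 0 := by
      rw [lintegral_congr fun x ↦ le_antisymm ((hgG x).trans hG0.le) zero_le]; simp
    rw [this, ENNReal.zero_rpow_of_pos hl0, mul_zero]
    exact zero_le
  set c := F ^ (1 - l) * G ^ l with hc
  have hc0 : c ≠ 0 := mul_ne_zero (by simp [hF0, hfb]) (by simp [hG0, hgb])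
  have hct : c ≠ ∞ := ENNReal.mul_ne_top (ENNReal.rpow_ne_top_of_nonneg h1l.le hfb)
    (ENNReal.rpow_ne_top_of_nonneg hl0.le hgb)
  have hfd : ∀ x, f x / F ≤ 1 := fun x ↦ ENNReal.div_le_of_le_mul (by simpa using hfF x)
  have hgd : ∀ x, g x / G ≤ 1 := fun x ↦ ENNReal.div_le_of_le_mul (by simpa using hgG x)
  -- Truncating h at c keeps it finite and loses nothing, since f^(1-l) g^l never exceeds c.
  have hhd : ∀ x, min (h x) c / c ≤ 1 := fun x ↦
    ENNReal.div_le_of_le_mul (by simp)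
  have hft : ∀ x, f x / F ≠ ∞ := fun x ↦ ((hfd x).trans_lt ENNReal.one_lt_top).ne
  have hgt : ∀ x, g x / G ≠ ∞ := fun x ↦ ((hgd x).trans_lt ENNReal.one_lt_top).ne
  have hht : ∀ x, min (h x) c / c ≠ ∞ := fun x ↦ ((hhd x).trans_lt ENNReal.one_lt_top).ne
  have hsup : ∀ (φ : ℝ → ℝ≥0∞) (Φ : ℝ≥0∞), Φ = ⨆ x, φ x → Φ ≠ 0 → Φ ≠ ∞ → (∀ x, φ x / Φ ≠ ∞) →
      ∀ t < (1 : ℝ), ∃ x, t < (φ x / Φ).toReal := by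
    intro φ Φ hΦ h0 htop hφ t ht
    rcases lt_or_ge t 0 with ht0 | ht0
    · exact ⟨0, ht0.trans_le ENNReal.toReal_nonneg⟩
    have hlt : ENNReal.ofReal t * Φ < Φ := by
      have := ENNReal.mul_lt_mul_left h0 htop (ENNReal.ofReal_lt_one.2 ht)
      rwa [one_mul] at this
    conv_rhs at hlt => rw [hΦ]
    obtain ⟨x, hx⟩ := lt_iSup_iff.1 hlt
    refine ⟨x, ?_⟩
    rw [← ENNReal.ofReal_lt_iff_lt_toReal ht0 (hφ x)]
    rw [ENNReal.lt_div_iff_mul_lt (.inl h0) (.inl htop)]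
    exact hx
  have main := lintegral_ofReal_superlevel (f := fun x ↦ (f x / F).toReal)
    (g := fun x ↦ (g x / G).toReal) (h := fun x ↦ (min (h x) c / c).toReal)
    (hf.div_const F).ennreal_toReal (hg.div_const G).ennreal_toReal
    ((hh.min measurable_const).div_const c).ennreal_toReal
    (fun x ↦ ENNReal.toReal_nonneg) (fun x ↦ ENNReal.toReal_nonneg) (fun x ↦ ENNReal.toReal_nonneg)
    (fun x ↦ ENNReal.toReal_le_of_le_ofReal zero_le_one (by simpa using hfd x))
    (fun x ↦ ENNReal.toReal_le_of_le_ofReal zero_le_one (by simpa using hgd x))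
    (hsup f F hF hF0 hfb hft) (hsup g G hG hG0 hgb hgt) hl0.le hl1.le (by
      intro x y t ht hx hy
      rw [← ENNReal.ofReal_lt_iff_lt_toReal ht.le (hft x),
        ENNReal.lt_div_iff_mul_lt (.inl hF0) (.inl hfb)] at hx
      rw [← ENNReal.ofReal_lt_iff_lt_toReal ht.le (hgt y),
        ENNReal.lt_div_iff_mul_lt (.inl hG0) (.inl hgb)] at hy
      rw [← ENNReal.ofReal_lt_iff_lt_toReal ht.le (hht _),
        ENNReal.lt_div_iff_mul_lt (.inl hc0) (.inl hct)]
      have e : ENNReal.ofReal t * c =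
          (ENNReal.ofReal t * F) ^ (1 - l) * (ENNReal.ofReal t * G) ^ l := by
        rw [ENNReal.mul_rpow_of_nonneg _ _ h1l.le, ENNReal.mul_rpow_of_nonneg _ _ hl0.le, hc]
        have : ENNReal.ofReal t ^ (1 - l) * ENNReal.ofReal t ^ l = ENNReal.ofReal t := by
          rw [← ENNReal.rpow_add _ _ (by simpa using ht) ENNReal.ofReal_ne_top]; simp
        calc _ = (ENNReal.ofReal t ^ (1 - l) * ENNReal.ofReal t ^ l) * (F ^ (1 - l) * G ^ l) := by
              rw [this]
          _ = _ := by ring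
      have h3 : ENNReal.ofReal t * c < f x ^ (1 - l) * g y ^ l := by
        rw [e]
        exact ENNReal.mul_lt_mul (ENNReal.rpow_lt_rpow hx h1l) (ENNReal.rpow_lt_rpow hy hl0)
      exact lt_min (h3.trans_le (H x y)) (h3.trans_le (mul_le_mul'
        (ENNReal.rpow_le_rpow (hfF x) h1l.le) (ENNReal.rpow_le_rpow (hgG y) hl0.le))))
  simp only [ENNReal.ofReal_toReal (hft _), ENNReal.ofReal_toReal (hgt _),
    ENNReal.ofReal_toReal (hht _)] at main
  simp only [div_eq_mul_inv] at main
  rw [lintegral_mul_const _ hf, lintegral_mul_const _ hg,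
    lintegral_mul_const _ (hh.min measurable_const)] at main
  have h4 := (ennreal_geom_mean_le _ _ hl0 hl1).trans main
  rw [ENNReal.mul_rpow_of_nonneg _ _ h1l.le, ENNReal.mul_rpow_of_nonneg _ _ hl0.le,
    ENNReal.inv_rpow, ENNReal.inv_rpow, mul_mul_mul_comm,
    ← ENNReal.mul_inv (.inl (by simp [hF0, hfb]))
      (.inl (ENNReal.rpow_ne_top_of_nonneg h1l.le hfb)), ← hc] at h4
  have h5 := mul_le_mul_left h4 c
  rw [mul_assoc, ENNReal.inv_mul_cancel hc0 hct, mul_one, mul_assoc,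
    ENNReal.inv_mul_cancel hc0 hct, mul_one] at h5
  exact h5.trans (lintegral_mono fun x ↦ min_le_left _ _)

theorem iSup_lintegral_min {f : ℝ → ℝ≥0∞} (hf : Measurable f) :
    Tendsto (fun k : ℕ ↦ ∫⁻ x, min (f x) k) atTop (𝓝 (∫⁻ x, f x)) := by
  refine lintegral_tendsto_of_tendsto_of_monotone
    (fun k ↦ (hf.min measurable_const).aemeasurable)
    (.of_forall fun x j k hjk ↦ min_le_min_left _ (by exact_mod_cast hjk))
    (.of_forall fun x ↦ ?_)
  have := (tendsto_const_nhds (x := f x) (f := (atTop : Filter ℕ))).min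
    ENNReal.tendsto_nat_nhds_top
  simpa using this

/-- The Prékopa–Leindler inequality on the line. -/
theorem prekopaLeindler_real {f g h : ℝ → ℝ≥0∞} (hf : Measurable f) (hg : Measurable g)
    (hh : Measurable h) {l : ℝ} (hl0 : 0 < l)
    (hl1 : l < 1) (H : ∀ x y, f x ^ (1 - l) * g y ^ l ≤ h ((1 - l) * x + l * y)) :
    (∫⁻ x, f x) ^ (1 - l) * (∫⁻ x, g x) ^ l ≤ ∫⁻ x, h x := by
  have h1l : 0 < 1 - l := by linarith
  rcases eq_or_ne (∫⁻ x, f x) 0 with hf0 | hf0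
  · rw [hf0, ENNReal.zero_rpow_of_pos h1l, zero_mul]; exact zero_le
  rcases eq_or_ne (∫⁻ x, g x) 0 with hg0 | hg0
  · rw [hg0, ENNReal.zero_rpow_of_pos hl0, mul_zero]; exact zero_le
  have hlim := ENNReal.Tendsto.mul ((iSup_lintegral_min hf).ennrpow_const (1 - l))
    (.inl (by simp only [ne_eq, ENNReal.rpow_eq_zero_iff]; rintro (h | h)
              · exact hf0 h.1
              · linarith [h.2]))
    ((iSup_lintegral_min hg).ennrpow_const l)
    (.inl (by simp only [ne_eq, ENNReal.rpow_eq_zero_iff]; rintro (h | h)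
              · exact hg0 h.1
              · linarith [h.2]))
  refine le_of_tendsto hlim (.of_forall fun k ↦ ?_)
  refine prekopaLeindler_real_of_bounded (hf.min measurable_const) (hg.min measurable_const) hh
    ?_ ?_ hl0 hl1 fun x y ↦ le_trans (mul_le_mul' (ENNReal.rpow_le_rpow (min_le_left _ _) h1l.le)
      (ENNReal.rpow_le_rpow (min_le_left _ _) hl0.le)) (H x y)
  · exact ((iSup_le fun x ↦ min_le_right _ _).trans_lt (ENNReal.natCast_lt_top k)).ne
  · exact ((iSup_le fun x ↦ min_le_right _ _).trans_lt (ENNReal.natCast_lt_top k)).ne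

theorem lintegral_fin_succ {m : ℕ} {f : (Fin (m + 1) → ℝ) → ℝ≥0∞} (hf : Measurable f) :
    ∫⁻ x, f x = ∫⁻ s : ℝ, ∫⁻ y : Fin m → ℝ, f (Fin.cons s y) := by
  have h := (volume_preserving_piFinSuccAbove (fun _ : Fin (m + 1) ↦ ℝ) 0).symm
  rw [← h.lintegral_comp hf, Measure.volume_eq_prod, lintegral_prod]
  · simp [MeasurableEquiv.piFinSuccAbove, Fin.insertNthEquiv]
  · exact (hf.comp (MeasurableEquiv.measurable _)).aemeasurable

theorem measurable_cons {m : ℕ} :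
    Measurable fun p : ℝ × (Fin m → ℝ) ↦ (Fin.cons p.1 p.2 : Fin (m + 1) → ℝ) := by
  rw [measurable_pi_iff]
  intro i
  refine Fin.cases ?_ (fun j ↦ ?_) i
  · simpa using measurable_fst
  · simpa using Measurable.eval measurable_snd

/-- The Prékopa–Leindler inequality. -/
theorem prekopaLeindler_pi {l : ℝ} (hl0 : 0 < l) (hl1 : l < 1) (m : ℕ)
    {f g h : (Fin m → ℝ) → ℝ≥0∞} (hf : Measurable f) (hg : Measurable g) (hh : Measurable h)
    (H : ∀ x y, f x ^ (1 - l) * g y ^ l ≤ h ((1 - l) • x + l • y)) :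
    (∫⁻ x, f x) ^ (1 - l) * (∫⁻ x, g x) ^ l ≤ ∫⁻ x, h x := by
  induction m with
  | zero =>
    have := H default default
    rw [lintegral_unique, lintegral_unique, lintegral_unique]
    have hv : (volume : Measure (Fin 0 → ℝ)) univ = 1 := by
      rw [volume_pi, Measure.pi_univ]; simp
    rw [hv, mul_one, mul_one, mul_one]
    rw [Subsingleton.elim ((1 - l) • (default : Fin 0 → ℝ) + l • default) default] at this
    convert this
  | succ m ih =>
    rw [lintegral_fin_succ hf, lintegral_fin_succ hg, lintegral_fin_succ hh]
    have hm : ∀ {φ : (Fin (m + 1) → ℝ) → ℝ≥0∞}, Measurable φ →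
        Measurable fun s : ℝ ↦ ∫⁻ y : Fin m → ℝ, φ (Fin.cons s y) := fun hφ ↦
      (hφ.comp measurable_cons).lintegral_prod_right'
    have hs : ∀ {φ : (Fin (m + 1) → ℝ) → ℝ≥0∞} (s : ℝ), Measurable φ →
        Measurable fun y : Fin m → ℝ ↦ φ (Fin.cons s y) := fun s hφ ↦
      hφ.comp (measurable_cons.comp measurable_prodMk_left)
    -- The induction hypothesis on slices shows that the slice integrals satisfy the one-dimensional
    -- hypothesis.
    refine prekopaLeindler_real (hm hf) (hm hg) (hm hh) hl0 hl1 fun s t ↦ ?_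
    refine ih (hs s hf) (hs t hg) (hs _ hh) fun x y ↦ ?_
    refine (H _ _).trans_eq ?_
    congr 1
    ext i
    refine Fin.cases ?_ (fun j ↦ ?_) i <;> simp

/-- The Brunn–Minkowski inequality. -/
theorem brunnMinkowski {n : ℕ} {A B C : Set (EuclideanSpace ℝ (Fin n))} (hA : MeasurableSet A)
    (hB : MeasurableSet B) (hC : MeasurableSet C) {t a b : ℝ} (ht0 : 0 < t) (ht1 : t < 1)
    (ha : 0 < a) (hb : 0 < b) (hAa : ENNReal.ofReal (a ^ n) ≤ volume A)
    (hBb : ENNReal.ofReal (b ^ n) ≤ volume B)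
    (h : ∀ x ∈ A, ∀ y ∈ B, (1 - t) • x + t • y ∈ C) :
    ENNReal.ofReal (((1 - t) * a + t * b) ^ n) ≤ volume C := by
  have ht1' : 0 < 1 - t := by linarith
  set θ := (1 - t) * a + t * b with hθ
  have hθ0 : 0 < θ := by positivity
  -- With l = tb/θ, (1 − l)a⁻¹x + l b⁻¹y = θ⁻¹((1 − t)x + ty). This reduces the claim to sets of
  -- volume at least one, where the multiplicative inequality suffices.
  have hl0 : 0 < t * b / θ := by positivity
  have hl : 1 - t * b / θ = (1 - t) * a / θ := by
    rw [hθ]; field_simp; ring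
  have hl1 : t * b / θ < 1 := by
    have : 0 < (1 - t) * a / θ := by positivity
    linarith
  have hone : ∀ {S : Set (EuclideanSpace ℝ (Fin n))} {r : ℝ}, 0 < r →
      volume (r⁻¹ • S) = (ENNReal.ofReal (r ^ n))⁻¹ * volume S := fun {S r} hr ↦ by
    rw [Measure.addHaar_smul_of_nonneg _ (inv_pos.2 hr).le, finrank_euclideanSpace_fin, inv_pow,
      ENNReal.ofReal_inv_of_pos (by positivity)]
  have hge : ∀ {S : Set (EuclideanSpace ℝ (Fin n))} {r : ℝ}, 0 < r →
      (ENNReal.ofReal (r ^ n) ≤ volume S ↔ 1 ≤ volume (r⁻¹ • S)) := fun {S r} hr ↦ by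
    have h0 : ENNReal.ofReal (r ^ n) ≠ 0 := by simpa using pow_pos hr n
    rw [hone hr, mul_comm, ← div_eq_mul_inv,
      ENNReal.le_div_iff_mul_le (.inl h0) (.inl ENNReal.ofReal_ne_top), one_mul]
  rw [hge ha] at hAa
  rw [hge hb] at hBb
  rw [hge hθ0]
  have e := PiLp.volume_preserving_toLp (Fin n)
  have hpre : ∀ {S : Set (EuclideanSpace ℝ (Fin n))}, MeasurableSet S →
      ∫⁻ x : Fin n → ℝ, ((WithLp.toLp 2 : (Fin n → ℝ) → EuclideanSpace ℝ (Fin n)) ⁻¹' S).indicator 1 x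
        = volume S := fun {S} hS ↦ by
    rw [lintegral_indicator_one (e.measurable hS), e.measure_preimage hS.nullMeasurableSet]
  have hmA := hA.const_smul₀ a⁻¹
  have hmB := hB.const_smul₀ b⁻¹
  have hmC := hC.const_smul₀ θ⁻¹
  have PL := prekopaLeindler_pi hl0 hl1 n
    (measurable_one.indicator (e.measurable hmA)) (measurable_one.indicator (e.measurable hmB))
    (measurable_one.indicator (e.measurable hmC)) (by
      intro x y
      by_cases hx : WithLp.toLp 2 x ∈ a⁻¹ • A
      swap
      · rw [indicator_of_notMem (by exact hx), ENNReal.zero_rpow_of_pos (by linarith), zero_mul]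
        exact zero_le
      by_cases hy : WithLp.toLp 2 y ∈ b⁻¹ • B
      swap
      · rw [indicator_of_notMem (s := WithLp.toLp 2 ⁻¹' (b⁻¹ • B)) (by exact hy), ENNReal.zero_rpow_of_pos hl0,
          mul_zero]
        exact zero_le
      have hz : WithLp.toLp 2 ((1 - t * b / θ) • x + (t * b / θ) • y) ∈ θ⁻¹ • C := by
        rw [mem_inv_smul_set_iff₀ ha.ne'] at hx
        rw [mem_inv_smul_set_iff₀ hb.ne'] at hy
        rw [mem_inv_smul_set_iff₀ hθ0.ne']
        have := h _ hx _ hy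
        rw [hl, WithLp.toLp_add, WithLp.toLp_smul, WithLp.toLp_smul, smul_add, smul_smul, smul_smul,
          mul_div_cancel₀ _ hθ0.ne', mul_div_cancel₀ _ hθ0.ne', ← smul_smul, ← smul_smul]
        exact this
      rw [indicator_of_mem (s := WithLp.toLp 2 ⁻¹' (a⁻¹ • A)) hx, indicator_of_mem (s := WithLp.toLp 2 ⁻¹' (b⁻¹ • B)) hy,
        indicator_of_mem (s := WithLp.toLp 2 ⁻¹' (θ⁻¹ • C)) hz]
      simp)
  rw [hpre hmA, hpre hmB, hpre hmC] at PL
  refine le_trans ?_ PL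
  calc (1 : ℝ≥0∞) = 1 ^ (1 - t * b / θ) * 1 ^ (t * b / θ) := by simp
    _ ≤ _ := mul_le_mul' (ENNReal.rpow_le_rpow hAa (by linarith)) (ENNReal.rpow_le_rpow hBb hl0.le)

end BrunnMinkowski

/-! ### Berwald's moment comparison with a cone -/

section Berwald

/-- The distribution function of the height above the base of a cone of height `h` and volume
one in dimension `n`. -/
noncomputable def coneDistrib (n : ℕ) (h t : ℝ) : ℝ≥0∞ :=
  (Iio h).indicator (fun t ↦ ENNReal.ofReal ((1 - t / h) ^ n)) t

theorem measurable_coneDistrib (n : ℕ) (h : ℝ) : Measurable (coneDistrib n h) :=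
  Measurable.indicator (Measurable.ennreal_ofReal (by fun_prop)) measurableSet_Iio

theorem lintegral_Ioo_ofReal {h : ℝ} (hh : 0 < h) {f F : ℝ → ℝ}
    (hF : ∀ x, HasDerivAt F (f x) x) (hf : Continuous f) (h0 : ∀ x ∈ Ioo 0 h, 0 ≤ f x) :
    ∫⁻ t in Ioo 0 h, ENNReal.ofReal (f t) = ENNReal.ofReal (F h - F 0) := by
  rw [← ofReal_integral_eq_lintegral_ofReal, ← integral_Ioc_eq_integral_Ioo,
    ← intervalIntegral.integral_of_le hh.le,
    intervalIntegral.integral_eq_sub_of_hasDerivAt (fun x _ ↦ hF x) (hf.intervalIntegrable _ _)]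
  · exact (hf.integrableOn_Icc).mono_set Ioo_subset_Icc_self
  · exact (ae_restrict_iff' measurableSet_Ioo).2 (.of_forall h0)

theorem one_sub_div_nonneg {h t : ℝ} (hh : 0 < h) (ht : t ∈ Ioo 0 h) : 0 ≤ 1 - t / h := by
  rw [sub_nonneg, div_le_one hh]; exact ht.2.le

theorem hasDerivAt_one_sub_div_pow (m : ℕ) (h t : ℝ) :
    HasDerivAt (fun t : ℝ ↦ (1 - t / h) ^ (m + 1)) (-((m + 1) * (1 - t / h) ^ m / h)) t := by
  have := (((hasDerivAt_id t).div_const h).const_sub 1).pow (m + 1)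
  refine this.congr_deriv ?_
  simp
  ring

theorem lintegral_coneDistrib (n : ℕ) {h : ℝ} (hh : 0 < h) :
    ∫⁻ t in Ioi 0, coneDistrib n h t = ENNReal.ofReal (h / (n + 1)) := by
  simp only [coneDistrib]
  rw [setLIntegral_indicator measurableSet_Iio, inter_comm, Ioi_inter_Iio,
    lintegral_Ioo_ofReal hh (F := fun t ↦ -(h / (n + 1)) * (1 - t / h) ^ (n + 1)) ?_ (by fun_prop)
    fun t ht ↦ pow_nonneg (one_sub_div_nonneg hh ht) n]
  · simp [hh.ne']
  · intro t
    refine ((hasDerivAt_one_sub_div_pow n h t).const_mul _).congr_deriv ?_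
    field_simp

theorem lintegral_coneDistrib_mul (n : ℕ) {h : ℝ} (hh : 0 < h) :
    ∫⁻ t in Ioi 0, coneDistrib n h t * ENNReal.ofReal t =
      ENNReal.ofReal (h ^ 2 / ((n + 1) * (n + 2))) := by
  have e : ∀ t, coneDistrib n h t * ENNReal.ofReal t =
      (Iio h).indicator (fun t ↦ ENNReal.ofReal ((1 - t / h) ^ n) * ENNReal.ofReal t) t := fun t ↦ by
    rw [coneDistrib, indicator_mul_left]
  simp only [e]
  rw [setLIntegral_indicator measurableSet_Iio, inter_comm, Ioi_inter_Iio]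
  have e2 : ∀ t ∈ Ioo 0 h, ENNReal.ofReal ((1 - t / h) ^ n) * ENNReal.ofReal t =
      ENNReal.ofReal ((1 - t / h) ^ n * t) := fun t ht ↦
    (ENNReal.ofReal_mul (pow_nonneg (one_sub_div_nonneg hh ht) n)).symm
  rw [setLIntegral_congr_fun measurableSet_Ioo e2,
    lintegral_Ioo_ofReal hh (F := fun t ↦ -(h ^ 2 / (n + 1)) * (1 - t / h) ^ (n + 1) +
      (h ^ 2 / (n + 2)) * (1 - t / h) ^ (n + 1 + 1)) ?_ (by fun_prop)
    fun t ht ↦ mul_nonneg (pow_nonneg (one_sub_div_nonneg hh ht) n) ht.1.le]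
  · congr 1
    simp [hh.ne']
    field_simp
    ring
  · intro t
    refine (((hasDerivAt_one_sub_div_pow n h t).const_mul _).add
      ((hasDerivAt_one_sub_div_pow (n + 1) h t).const_mul _)).congr_deriv ?_
    have ht : t = h * (1 - (1 - t / h)) := by field_simp; ring
    generalize 1 - t / h = w at ht
    subst ht
    push_cast
    field_simp
    ring

theorem lintegral_eq_layercake {α : Type*} [MeasurableSpace α] (μ : Measure α) {f : α → ℝ}
    (hf : Measurable f) (h0 : 0 ≤ᵐ[μ] f) :
    ∫⁻ x, ENNReal.ofReal (f x) ∂μ = ∫⁻ t in Ioi 0, μ {a | t ≤ f a} :=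
  lintegral_eq_lintegral_meas_le μ h0 hf.aemeasurable

theorem lintegral_sq_eq_layercake {α : Type*} [MeasurableSpace α] (μ : Measure α) {f : α → ℝ}
    (hf : Measurable f) (h0 : 0 ≤ᵐ[μ] f) :
    ∫⁻ x, ENNReal.ofReal (f x ^ 2) ∂μ =
      2 * ∫⁻ t in Ioi 0, μ {a | t ≤ f a} * ENNReal.ofReal t := by
  have := lintegral_rpow_eq_lintegral_meas_le_mul μ h0 hf.aemeasurable (p := 2) two_pos
  have e : (2 : ℝ) - 1 = 1 := by norm_num
  simpa [e] using this

/-- The equality case of the comparison, used for barycentric coordinates with h = 1. -/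
theorem lintegral_eq_of_distrib_eq {α : Type*} [MeasurableSpace α] (μ : Measure α) {f : α → ℝ}
    (hf : Measurable f) (h0 : 0 ≤ᵐ[μ] f) (n : ℕ) {h : ℝ} (hh : 0 < h)
    (H : ∀ t > 0, μ {a | t ≤ f a} = coneDistrib n h t) :
    ∫⁻ x, ENNReal.ofReal (f x) ∂μ = ENNReal.ofReal (h / (n + 1)) ∧
    ∫⁻ x, ENNReal.ofReal (f x ^ 2) ∂μ = ENNReal.ofReal (2 * h ^ 2 / ((n + 1) * (n + 2))) := by
  constructor
  · rw [lintegral_eq_layercake μ hf h0, setLIntegral_congr_fun measurableSet_Ioi H,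
      lintegral_coneDistrib n hh]
  · have e : ∀ t ∈ Ioi (0 : ℝ), μ {a | t ≤ f a} * ENNReal.ofReal t =
        coneDistrib n h t * ENNReal.ofReal t := fun t ht ↦ by rw [H t ht]
    rw [lintegral_sq_eq_layercake μ hf h0, setLIntegral_congr_fun measurableSet_Ioi e,
      lintegral_coneDistrib_mul n hh, mul_div_assoc, ENNReal.ofReal_mul zero_le_two]
    simp

/-- The inequality (a − b)(t − s) ≤ 0, written without subtraction in `ℝ≥0∞`. -/
theorem crossing_mul_le {a b t s : ℝ≥0∞} (h1 : t < s → b ≤ a) (h2 : s < t → a ≤ b) :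
    a * t + b * s ≤ b * t + a * s := by
  rcases lt_trichotomy t s with h | h | h
  · obtain ⟨d, rfl⟩ := exists_add_of_le h.le
    calc a * t + b * (t + d) = (a * t + b * t) + b * d := by ring
      _ ≤ (a * t + b * t) + a * d := by gcongr; exact h1 h
      _ = _ := by ring
  · rw [h, add_comm]
  · obtain ⟨d, rfl⟩ := exists_add_of_le h.le
    calc a * (s + d) + b * s = (a * s + b * s) + a * d := by ring
      _ ≤ (a * s + b * s) + b * d := by gcongr; exact h2 h
      _ = _ := by ring

/-- If the distribution function of `f` crosses that of a cone with the same mean at most once,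
from above, then the second moment of `f` is at most the one for the cone. -/
theorem lintegral_sq_le_of_crossing {α : Type*} [MeasurableSpace α] (μ : Measure α) {f : α → ℝ}
    (hf : Measurable f) (h0 : 0 ≤ᵐ[μ] f) (n : ℕ) {h : ℝ} (hh : 0 < h)
    (hmean : ∫⁻ x, ENNReal.ofReal (f x) ∂μ = ENNReal.ofReal (h / (n + 1))) {t₀ : ℝ}
    (h1 : ∀ t > 0, t < t₀ → coneDistrib n h t ≤ μ {a | t ≤ f a})
    (h2 : ∀ t > 0, t₀ < t → μ {a | t ≤ f a} ≤ coneDistrib n h t) :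
    ∫⁻ x, ENNReal.ofReal (f x ^ 2) ∂μ ≤ ENNReal.ofReal (2 * h ^ 2 / ((n + 1) * (n + 2))) := by
  have hM : Measurable fun t : ℝ ↦ μ {a | t ≤ f a} :=
    Antitone.measurable fun s t hst ↦ measure_mono fun x (hx : t ≤ f x) ↦ hst.trans hx
  have hG := measurable_coneDistrib n h
  have hid : Measurable fun t : ℝ ↦ ENNReal.ofReal t := ENNReal.measurable_ofReal
  rw [lintegral_eq_layercake μ hf h0] at hmean
  -- Integrating (M(t) − G(t))(t − t₀) ≤ 0, with M and G the two distribution functions. Their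
  -- integrals are the equal means, so the t₀ terms cancel.
  have key : (∫⁻ t in Ioi 0, μ {a | t ≤ f a} * ENNReal.ofReal t) +
      ENNReal.ofReal (h / (n + 1)) * ENNReal.ofReal t₀ ≤
      (∫⁻ t in Ioi 0, coneDistrib n h t * ENNReal.ofReal t) +
      ENNReal.ofReal (h / (n + 1)) * ENNReal.ofReal t₀ := by
    nth_rewrite 1 [← lintegral_coneDistrib n hh]
    rw [← hmean, ← lintegral_mul_const _ hG, ← lintegral_mul_const _ hM,
      ← lintegral_add_left (show Measurable fun t ↦ μ {a | t ≤ f a} * ENNReal.ofReal t from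
        hM.mul hid),
      ← lintegral_add_left (show Measurable fun t ↦ coneDistrib n h t * ENNReal.ofReal t from
        hG.mul hid)]
    refine setLIntegral_mono ((hG.mul hid).add (hM.mul_const _)) fun t (ht : 0 < t) ↦ ?_
    refine crossing_mul_le (fun hlt ↦ h1 t ht ?_) (fun hlt ↦ h2 t ht ?_)
    · exact (ENNReal.ofReal_lt_ofReal_iff_of_nonneg ht.le).1 hlt
    · exact (ENNReal.ofReal_lt_ofReal_iff ht).1 hlt
  have key2 := (ENNReal.add_le_add_iff_right
    (ENNReal.mul_ne_top ENNReal.ofReal_ne_top ENNReal.ofReal_ne_top)).1 key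
  rw [lintegral_sq_eq_layercake μ hf h0, mul_div_assoc, ENNReal.ofReal_mul zero_le_two,
    ← lintegral_coneDistrib_mul n hh]
  simpa using mul_le_mul_right key2 2

variable {n : ℕ}

local notation "𝔼" => EuclideanSpace ℝ (Fin n)

/-- Berwald's inequality between the first two moments of a nonnegative affine function on a convex
body. -/
theorem lintegral_sq_le_of_convex (hn : 1 ≤ n) {K : Set 𝔼} (hK : Convex ℝ K) (hKc : IsCompact K)
    (hK1 : volume K = 1) (ξ : 𝔼) {b : ℝ} (hb : 0 < b) (hKb : ∀ x ∈ K, inner ℝ x ξ ≤ b)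
    (hmean : ∫⁻ x in K, ENNReal.ofReal (b - inner ℝ x ξ) = ENNReal.ofReal b) :
    ∫⁻ x in K, ENNReal.ofReal ((b - inner ℝ x ξ) ^ 2) ≤
      ENNReal.ofReal (2 * ((n + 1) * b) ^ 2 / ((n + 1) * (n + 2))) := by
  set Y : 𝔼 → ℝ := fun x ↦ b - inner ℝ x ξ with hY
  -- The height for which the cone has mean h/(n+1) = b.
  set h := (n + 1) * b with hh
  have hhpos : 0 < h := by positivity
  have hYc : Continuous Y := by fun_prop
  have hKm := hKc.measurableSet
  have hY0 : 0 ≤ᵐ[volume.restrict K] Y :=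
    (ae_restrict_iff' hKm).2 (.of_forall fun x hx ↦ sub_nonneg.2 (hKb x hx))
  have hlev : ∀ t, MeasurableSet {x | t ≤ Y x} := fun t ↦
    (isClosed_le continuous_const hYc).measurableSet
  have hres : ∀ t, volume.restrict K {x | t ≤ Y x} = volume ({x | t ≤ Y x} ∩ K) := fun t ↦
    Measure.restrict_apply (hlev t)
  have hM1 : ∀ t, volume ({x | t ≤ Y x} ∩ K) ≠ ∞ := fun t ↦
    ((measure_mono inter_subset_right).trans_lt hKc.measure_lt_top).ne
  -- Levels where the cone lies strictly below. Brunn–Minkowski shows that the cone is at most the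
  -- distribution function at all smaller levels, so the crossing is at `sSup D`.
  set D : Set ℝ := {s | 0 < s ∧ coneDistrib n h s < volume ({x | s ≤ Y x} ∩ K)} with hD
  have hDprop : ∀ s ∈ D, ∀ t, 0 < t → t < s →
      coneDistrib n h t ≤ volume ({x | t ≤ Y x} ∩ K) := by
    rintro s ⟨hs0, hs⟩ t ht hts
    rcases lt_or_ge t h with hth | hth
    swap
    · rw [coneDistrib, indicator_of_notMem (by simpa using hth)]; exact zero_le
    set v := (volume ({x | s ≤ Y x} ∩ K)).toReal with hv
    have hv' : volume ({x | s ≤ Y x} ∩ K) = ENNReal.ofReal v := (ENNReal.ofReal_toReal (hM1 s)).symm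
    have hvpos : 0 < v := by
      rw [hv', ] at hs
      exact ENNReal.ofReal_pos.1 (zero_le.trans_lt hs)
    set β := v ^ ((n : ℝ)⁻¹) with hβ
    have hβpos : 0 < β := Real.rpow_pos_of_pos hvpos _
    have hβn : β ^ n = v := Real.rpow_inv_natCast_pow hvpos.le (by omega)
    have hτ0 : 0 < t / s := div_pos ht hs0
    have hτ1 : t / s < 1 := (div_lt_one hs0).2 hts
    -- By concavity and Y ≥ 0, the level set {Y ≥ t} contains (1 − t/s)K + (t/s){Y ≥ s}.
    have hBM := brunnMinkowski (A := K) (B := {x | s ≤ Y x} ∩ K) (C := {x | t ≤ Y x} ∩ K)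
      hKm ((hlev s).inter hKm) ((hlev t).inter hKm) hτ0 hτ1 one_pos hβpos
      (by rw [hK1]; simp) (by rw [hv', hβn]) (by
        rintro x hx y ⟨hys, hy⟩
        refine ⟨?_, hK hx hy (by linarith) hτ0.le (by ring)⟩
        have hx0 : 0 ≤ Y x := sub_nonneg.2 (hKb x hx)
        have e : Y ((1 - t / s) • x + (t / s) • y) = (1 - t / s) * Y x + (t / s) * Y y := by
          simp only [hY, inner_add_left, inner_smul_left, conj_trivial]; ring
        change t ≤ Y _
        rw [e]
        have h1 : (t / s) * s ≤ (t / s) * Y y := mul_le_mul_of_nonneg_left hys hτ0.le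
        rw [div_mul_cancel₀ _ hs0.ne'] at h1
        have h2 : 0 ≤ (1 - t / s) * Y x := mul_nonneg (by linarith) hx0
        linarith)
    refine le_trans ?_ hBM
    rw [coneDistrib, indicator_of_mem (show t ∈ Iio h from hth)]
    refine ENNReal.ofReal_le_ofReal (pow_le_pow_left₀
      (one_sub_div_nonneg hhpos ⟨ht, hth⟩) ?_ n)
    -- For s < h, 1 − t/h = (1 − t/s) + (t/s)(1 − s/h) and β exceeds 1 − s/h; for s ≥ h the first
    -- term alone suffices.
    rcases lt_or_ge s h with hsh | hsh
    · rw [coneDistrib, indicator_of_mem (show s ∈ Iio h from hsh), hv',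
        ENNReal.ofReal_lt_ofReal_iff hvpos, ← hβn] at hs
      have h3 := lt_of_pow_lt_pow_left₀ n hβpos.le hs
      have h4 : (t / s) * (1 - s / h) ≤ (t / s) * β := mul_le_mul_of_nonneg_left h3.le hτ0.le
      have h5 : (t / s) * (1 - s / h) = t / s - t / h := by field_simp
      linarith
    · have h3 : t / s ≤ t / h := div_le_div_of_nonneg_left ht.le hhpos hsh
      have h4 : 0 ≤ t / s * β := by positivity
      linarith
  have hDb : BddAbove D := by
    obtain ⟨R, hR⟩ := (hKc.image hYc).bddAbove
    refine ⟨R, fun s hs ↦ ?_⟩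
    by_contra! hlt
    have : {x | s ≤ Y x} ∩ K = ∅ := eq_empty_of_forall_notMem fun x hx ↦
      absurd (hR ⟨x, hx.2, rfl⟩) (not_le.2 (hlt.trans_le hx.1))
    have h2 := hs.2
    rw [this, measure_empty] at h2
    exact absurd h2 (not_lt.2 zero_le)
  refine lintegral_sq_le_of_crossing (volume.restrict K) hYc.measurable hY0 n hhpos ?_
    (t₀ := sSup D) ?_ ?_
  · rw [hmean, hh, mul_div_cancel_left₀ _ (by positivity)]
  · intro t ht htD
    rw [hres]
    -- For empty D the supremum takes the default value 0, and no t > 0 lies below it.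
    have hne : D.Nonempty := by
      by_contra hcon
      rw [not_nonempty_iff_eq_empty.1 hcon, Real.sSup_empty] at htD
      linarith
    obtain ⟨s, hs, hts⟩ := exists_lt_of_lt_csSup hne htD
    exact hDprop s hs t ht hts
  · intro t ht htD
    rw [hres]
    by_contra! hcon
    exact absurd (le_csSup hDb ⟨ht, hcon⟩) (not_le.2 htD)

end Berwald

/-! ### The ball inside an isotropic body -/

section InnerRadius

variable {n : ℕ}

local notation "𝔼" => EuclideanSpace ℝ (Fin n)

theorem integrableOn_of_continuous {F : Type*} [NormedAddCommGroup F] {K : Set 𝔼}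
    (hK : IsCompact K) {f : 𝔼 → F} (hf : Continuous f) : IntegrableOn f K :=
  hf.continuousOn.integrableOn_compact hK

theorem integral_inner_eq_zero {K : Set 𝔼} (hKc : IsCompact K) (hbar : ∫ x in K, x = 0) (ξ : 𝔼) :
    ∫ x in K, inner ℝ x ξ = 0 := by
  have h := integral_inner (𝕜 := ℝ) (μ := volume.restrict K) (f := fun x : 𝔼 ↦ x)
    (integrableOn_of_continuous hKc continuous_id) ξ
  rw [hbar, inner_zero_right] at h
  simpa only [real_inner_comm] using h

theorem integral_const_sub_inner {K : Set 𝔼} (hKc : IsCompact K) (hK1 : volume K = 1)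
    (hbar : ∫ x in K, x = 0) (ξ : 𝔼) (b : ℝ) : ∫ x in K, (b - inner ℝ x ξ) = b := by
  have hi : IntegrableOn (fun x : 𝔼 ↦ inner ℝ x ξ) K :=
    integrableOn_of_continuous hKc (by fun_prop)
  rw [integral_sub (integrableOn_of_continuous hKc continuous_const) hi,
    integral_inner_eq_zero hKc hbar, setIntegral_const, measureReal_def, hK1]
  simp

theorem integral_const_sub_inner_sq {K : Set 𝔼} (hKc : IsCompact K) (hK1 : volume K = 1)
    (hbar : ∫ x in K, x = 0) (ξ : 𝔼) (b : ℝ) :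
    ∫ x in K, (b - inner ℝ x ξ) ^ 2 = b ^ 2 + ∫ x in K, (inner ℝ x ξ) ^ 2 := by
  have hi : IntegrableOn (fun x : 𝔼 ↦ inner ℝ x ξ) K :=
    integrableOn_of_continuous hKc (by fun_prop)
  have hi2 : IntegrableOn (fun x : 𝔼 ↦ inner ℝ x ξ ^ 2) K :=
    integrableOn_of_continuous hKc (by fun_prop)
  have e : ∀ x : 𝔼, (b - inner ℝ x ξ) ^ 2 = (b ^ 2 - 2 * b * inner ℝ x ξ) + inner ℝ x ξ ^ 2 :=
    fun x ↦ by ring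
  simp only [e]
  have hi3 : IntegrableOn (fun x : 𝔼 ↦ b ^ 2 - 2 * b * inner ℝ x ξ) K :=
    integrableOn_of_continuous hKc (by fun_prop)
  rw [integral_add hi3 hi2, integral_sub (integrableOn_of_continuous hKc continuous_const) (hi.const_mul _),
    integral_const_mul, integral_inner_eq_zero hKc hbar, setIntegral_const, measureReal_def, hK1]
  simp

/-- Berwald's inequality for b − ⟨x, ξ⟩, with mean b and second moment b² + L². -/
theorem isotropicConstant_sq_le (hn : 1 ≤ n) {K : Set 𝔼} (hK : IsIsotropicBody K) {L : ℝ}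
    (hL : IsIsotropicConstant K L) {ξ : 𝔼} (hξ : ‖ξ‖ = 1) {b : ℝ} (hb : 0 < b)
    (hKb : ∀ x ∈ K, inner ℝ x ξ ≤ b) : L ^ 2 ≤ n / (n + 2) * b ^ 2 := by
  obtain ⟨⟨hcv, hKc, -⟩, hK1, hbar, -⟩ := hK
  have hKm := hKc.measurableSet
  have h1 : ∫⁻ x in K, ENNReal.ofReal (b - inner ℝ x ξ) = ENNReal.ofReal b := by
    rw [← ofReal_integral_eq_lintegral_ofReal, integral_const_sub_inner hKc hK1 hbar]
    · exact integrableOn_of_continuous hKc (by fun_prop)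
    · exact (ae_restrict_iff' hKm).2 (.of_forall fun x hx ↦ sub_nonneg.2 (hKb x hx))
  have h2 := lintegral_sq_le_of_convex hn hcv hKc hK1 ξ hb hKb h1
  rw [← ofReal_integral_eq_lintegral_ofReal, integral_const_sub_inner_sq hKc hK1 hbar, hL.2 ξ hξ,
    ENNReal.ofReal_le_ofReal_iff (by positivity)] at h2
  · have e : 2 * ((n + 1) * b) ^ 2 / ((n + 1) * (n + 2)) = b ^ 2 + n / (n + 2) * b ^ 2 := by
      field_simp
      ring
    linarith
  · exact integrableOn_of_continuous hKc (by fun_prop)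
  · exact .of_forall fun x ↦ sq_nonneg _

/-- An isotropic convex body contains a ball of radius `√((n + 2) / n)` times its isotropic
constant. -/
theorem closedBall_subset_of_isotropic (hn : 1 ≤ n) {K : Set 𝔼} (hK : IsIsotropicBody K) {L : ℝ}
    (hL : IsIsotropicConstant K L) :
    Metric.closedBall 0 (L * Real.sqrt ((n + 2) / n)) ⊆ K := by
  have hn0 : (0 : ℝ) < n := by exact_mod_cast hn
  set r := L * Real.sqrt ((n + 2) / n) with hr
  have hr0 : 0 < r := mul_pos hL.1 (Real.sqrt_pos.2 (by positivity))
  have hr2 : n / (n + 2) * r ^ 2 = L ^ 2 := by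
    rw [hr, mul_pow, Real.sq_sqrt (by positivity)]
    field_simp
  intro y hy
  by_contra hyK
  obtain ⟨u, hu, hlt⟩ := exists_supportFun_lt hK.1.1 hK.1.2.1
    (hK.1.2.2.mono interior_subset) hyK
  have hur : supportFun K u < r := by
    refine hlt.trans_le ((real_inner_le_norm _ _).trans ?_)
    rw [hu, one_mul]
    simpa using hy
  -- The maximum with r / 2 makes b positive before the origin is known to be interior, and still
  -- keeps b < r.
  set b := max (supportFun K u) (r / 2) with hb
  have hbr : b < r := max_lt hur (by linarith)
  have hb0 : 0 < b := lt_max_of_lt_right (by linarith)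
  have := isotropicConstant_sq_le hn hK hL hu hb0 fun x hx ↦ by
    rw [real_inner_comm]
    exact (inner_le_supportFun hK.1.2.1 u hx).trans (le_max_left _ _)
  rw [← hr2] at this
  have h3 : b ^ 2 < r ^ 2 := pow_lt_pow_left₀ hbr hb0.le two_ne_zero
  have h4 : (0 : ℝ) < n / (n + 2) := by positivity
  nlinarith

end InnerRadius

/-! ### Isotropic simplices: the equality case -/

section Simplices

variable {n : ℕ}

local notation "𝔼" => EuclideanSpace ℝ (Fin n)

theorem IsIsotropicConstant.integral_inner_sq {K : Set 𝔼} {L : ℝ} (hL : IsIsotropicConstant K L)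
    (η : 𝔼) : ∫ x in K, (inner ℝ x η) ^ 2 = ‖η‖ ^ 2 * L ^ 2 := by
  rcases eq_or_ne η 0 with rfl | hη
  · simp
  have h := hL.2 (‖η‖⁻¹ • η) (norm_smul_inv_norm hη)
  have hpos := norm_pos_iff.2 hη
  rw [← h, ← integral_const_mul]
  refine integral_congr_ae (.of_forall fun x ↦ ?_)
  simp only [inner_smul_right]
  field_simp

/-- The part of a simplex where a barycentric coordinate is at least `t` is a homothetic copy. -/
theorem superlevel_coord_inter_convexHull (b : AffineBasis (Fin (n + 1)) ℝ 𝔼) (i : Fin (n + 1))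
    {t : ℝ} (ht0 : 0 ≤ t) (ht1 : t < 1) :
    {x | t ≤ b.coord i x} ∩ convexHull ℝ (range b) =
      AffineMap.homothety (b i) (1 - t) '' convexHull ℝ (range b) := by
  have h1t : 0 < 1 - t := by linarith
  have hco : ∀ (c : ℝ) (y : 𝔼) (j : Fin (n + 1)), b.coord j (AffineMap.homothety (b i) c y) =
      c * b.coord j y + (1 - c) * (if j = i then 1 else 0) := fun c y j ↦ by
    rw [AffineMap.homothety_eq_lineMap, AffineMap.apply_lineMap, AffineMap.lineMap_apply,
      b.coord_apply]
    simp only [vsub_eq_sub, vadd_eq_add, smul_eq_mul]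
    ring
  rw [b.convexHull_eq_nonneg_coord]
  ext x
  constructor
  · rintro ⟨hxt, hx⟩
    refine ⟨AffineMap.homothety (b i) (1 - t)⁻¹ x, fun j ↦ ?_, ?_⟩
    · rw [hco]
      have e : (1 - t)⁻¹ * b.coord j x + (1 - (1 - t)⁻¹) * (if j = i then 1 else 0) =
          (1 - t)⁻¹ * (b.coord j x - t * (if j = i then 1 else 0)) := by
        field_simp
        ring
      rw [e]
      refine mul_nonneg (inv_pos.2 h1t).le ?_
      split_ifs with hji
      · rw [mul_one, sub_nonneg, hji]; exact hxt
      · rw [mul_zero, sub_zero]; exact hx j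
    · rw [← AffineMap.homothety_mul_apply, mul_inv_cancel₀ h1t.ne', AffineMap.homothety_one]
      rfl
  · rintro ⟨y, hy, rfl⟩
    constructor
    · rw [mem_ofPred_eq, hco, if_pos rfl]
      have := mul_nonneg h1t.le (hy i)
      linarith
    · intro j
      rw [hco]
      refine add_nonneg (mul_nonneg h1t.le (hy j)) ?_
      split_ifs <;> linarith

/-- For t < 1 the set is a copy of the simplex shrunk by 1 − t; for t ≥ 1 it is at most a vertex,
which is null as n ≥ 1. -/
theorem volume_superlevel_coord (hn : 1 ≤ n) (b : AffineBasis (Fin (n + 1)) ℝ 𝔼)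
    (hK1 : volume (convexHull ℝ (range b)) = 1) (i : Fin (n + 1)) {t : ℝ} (ht : 0 < t) :
    volume ({x | t ≤ b.coord i x} ∩ convexHull ℝ (range b)) = coneDistrib n 1 t := by
  rw [coneDistrib]
  rcases lt_or_ge t 1 with ht1 | ht1
  · rw [indicator_of_mem (show t ∈ Iio 1 from ht1), superlevel_coord_inter_convexHull b i ht.le ht1,
      Measure.addHaar_image_homothety, hK1, mul_one, finrank_euclideanSpace_fin, div_one,
      abs_of_nonneg (pow_nonneg (by linarith) n)]
  · rw [indicator_of_notMem (by simpa using ht1)]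
    have : Nonempty (Fin n) := ⟨⟨0, hn⟩⟩
    refine measure_mono_null (t := {b i}) ?_ (measure_singleton _)
    rintro x ⟨hxt, hx⟩
    rw [b.convexHull_eq_nonneg_coord] at hx
    have hsum := b.sum_coord_apply_eq_one x
    rw [← Finset.add_sum_erase _ _ (Finset.mem_univ i)] at hsum
    have hxi : 1 ≤ b.coord i x := ht1.trans hxt
    have h0 : 0 ≤ ∑ j ∈ Finset.univ.erase i, b.coord j x := Finset.sum_nonneg fun j _ ↦ hx j
    have h1 : ∑ j ∈ Finset.univ.erase i, b.coord j x = 0 := by linarith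
    rw [Finset.sum_eq_zero_iff_of_nonneg fun j _ ↦ hx j] at h1
    refine b.ext_elem fun j ↦ ?_
    rw [b.coord_apply]
    split_ifs with hji
    · rw [hji]; linarith
    · exact h1 j (Finset.mem_erase.2 ⟨hji, Finset.mem_univ j⟩)

theorem continuous_coord (b : AffineBasis (Fin (n + 1)) ℝ 𝔼) (i : Fin (n + 1)) :
    Continuous (b.coord i) :=
  (b.coord i).continuous_of_finiteDimensional

theorem integral_coord (hn : 1 ≤ n) (b : AffineBasis (Fin (n + 1)) ℝ 𝔼)
    (hK1 : volume (convexHull ℝ (range b)) = 1) (i : Fin (n + 1)) :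
    ∫ x in convexHull ℝ (range b), b.coord i x = 1 / (n + 1) ∧
    ∫ x in convexHull ℝ (range b), b.coord i x ^ 2 = 2 / ((n + 1) * (n + 2)) := by
  have hKc : IsCompact (convexHull ℝ (range b)) := (finite_range b).isCompact_convexHull ℝ
  have hcont := continuous_coord b i
  have hlev : ∀ t, MeasurableSet {x | t ≤ b.coord i x} := fun t ↦
    (isClosed_le continuous_const hcont).measurableSet
  have h0 : 0 ≤ᵐ[volume.restrict (convexHull ℝ (range b))] b.coord i := by
    refine (ae_restrict_iff' hKc.measurableSet).2 (.of_forall fun x hx ↦ ?_)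
    rw [b.convexHull_eq_nonneg_coord] at hx
    exact hx i
  obtain ⟨h1, h2⟩ := lintegral_eq_of_distrib_eq (volume.restrict (convexHull ℝ (range b)))
    hcont.measurable h0 n one_pos fun t ht ↦ by
      rw [Measure.restrict_apply (hlev t), volume_superlevel_coord hn b hK1 i ht]
  constructor
  · rw [integral_eq_lintegral_of_nonneg_ae h0 hcont.aestronglyMeasurable, h1,
      ENNReal.toReal_ofReal (by positivity)]
  · rw [integral_eq_lintegral_of_nonneg_ae (.of_forall fun x ↦ sq_nonneg _)
      (hcont.pow 2).aestronglyMeasurable, h2, ENNReal.toReal_ofReal (by positivity)]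
    simp

theorem exists_coord_eq_add_inner (b : AffineBasis (Fin (n + 1)) ℝ 𝔼) (i : Fin (n + 1)) :
    ∃ (c : ℝ) (g : 𝔼), ∀ x, b.coord i x = c - inner ℝ x g := by
  set f : StrongDual ℝ 𝔼 := LinearMap.toContinuousLinearMap (b.coord i).linear
  refine ⟨b.coord i 0, -(InnerProductSpace.toDual ℝ 𝔼).symm f, fun x ↦ ?_⟩
  rw [inner_neg_right, real_inner_comm, InnerProductSpace.toDual_symm_apply]
  have := congrFun (AffineMap.decomp' (b.coord i)) x
  simp only [Pi.sub_apply] at this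
  simp only [f, LinearMap.coe_toContinuousLinearMap', this]
  ring

/-- An isotropic simplex is circumscribed about a ball of radius `√((n + 2) / n)` times its isotropic
constant. -/
theorem le_perimeter_of_simplex (hn : 1 ≤ n) (b : AffineBasis (Fin (n + 1)) ℝ 𝔼) {L : ℝ}
    (hK : IsIsotropicBody (convexHull ℝ (range b)))
    (hL : IsIsotropicConstant (convexHull ℝ (range b)) L) :
    ENNReal.ofReal (n / (L * Real.sqrt ((n + 2) / n))) ≤
      perimeter volume (convexHull ℝ (range b)) := by
  obtain ⟨⟨-, hKc, -⟩, hK1, hbar, -⟩ := hK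
  have hn0 : (0 : ℝ) < n := by exact_mod_cast hn
  set ρ := L * Real.sqrt ((n + 2) / n) with hρ
  have hρ0 : 0 < ρ := mul_pos hL.1 (Real.sqrt_pos.2 (by positivity))
  have hρ2 : n * ρ ^ 2 = (n + 2) * L ^ 2 := by
    rw [hρ, mul_pow, Real.sq_sqrt (by positivity)]
    field_simp
  choose c g hg using exists_coord_eq_add_inner b
  have hc : ∀ i, c i = 1 / (n + 1) := fun i ↦ by
    have h := (integral_coord hn b hK1 i).1
    simp only [hg i] at h
    rwa [integral_const_sub_inner hKc hK1 hbar] at h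
  -- The second moment determines ‖g i‖. Facet i is then at distance c i / ‖g i‖ = ρ from the
  -- origin, the same for all i.
  have hgn : ∀ i, ‖g i‖ = 1 / ((n + 1) * ρ) := fun i ↦ by
    have h := (integral_coord hn b hK1 i).2
    simp only [hg i] at h
    rw [integral_const_sub_inner_sq hKc hK1 hbar, hL.integral_inner_sq, hc] at h
    refine (sq_eq_sq₀ (norm_nonneg _) (by positivity)).1 ?_
    have hL2 : L ^ 2 = n * ρ ^ 2 / (n + 2) := by rw [hρ2]; field_simp
    rw [hL2] at h
    have h3 : ‖g i‖ ^ 2 * (n * ρ ^ 2 / (n + 2)) = n / ((n + 1) ^ 2 * (n + 2)) := by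
      rw [eq_sub_of_add_eq' h]
      field_simp
      ring
    field_simp at h3 ⊢
    exact h3
  have hgpos : ∀ i, 0 < ‖g i‖ := fun i ↦ by rw [hgn]; positivity
  set u : Fin (n + 1) → 𝔼 := fun i ↦ ‖g i‖⁻¹ • g i with hu
  have hunit : ∀ i, ‖u i‖ = 1 := fun i ↦ norm_smul_inv_norm (norm_pos_iff.1 (hgpos i))
  -- Equal normals would make two barycentric coordinates the same function, yet they differ at the
  -- vertex `b i`.
  have hinj : Function.Injective u := fun i j hij ↦ by
    have hgij : g i = g j := by
      have h2 : ‖g i‖ = ‖g j‖ := by rw [hgn, hgn]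
      simp only [hu, h2] at hij
      exact smul_right_injective _ (inv_pos.2 (hgpos j)).ne' hij
    by_contra hne
    have h1 := b.coord_apply i i
    have h2 := b.coord_apply j i
    rw [hg i, hc, hgij, if_pos rfl] at h1
    rw [hg j, hc, if_neg (Ne.symm hne)] at h2
    linarith
  have hKQ : convexHull ℝ (range b) = polyhedron u fun _ ↦ ρ := by
    rw [b.convexHull_eq_nonneg_coord]
    ext x
    refine forall_congr' fun i ↦ ?_
    rw [hg i, hc, sub_nonneg, real_inner_comm, hu, inner_smul_left, conj_trivial,
      inv_mul_le_iff₀ (hgpos i), hgn]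
    have : 1 / ((n + 1) * ρ) * ρ = 1 / (n + 1 : ℝ) := by field_simp
    rw [this]
  have := le_perimeter_of_circumscribed hunit hinj hρ0 (by rw [← hKQ]; exact hKc.isBounded)
  rwa [← hKQ, hK1, mul_one] at this

end Simplices

/-! ### Existence of isotropic regular simplices -/

section RegularSimplex

variable {n : ℕ}

local notation "𝔼" => EuclideanSpace ℝ (Fin n)

/-- The vertices `p` form a centred regular simplex, with the given scale `a` of the Gram
matrix. -/
def IsCentredRegular (p : Fin (n + 1) → 𝔼) (a : ℝ) : Prop :=
  ∀ i j, inner ℝ (p i) (p j) = a * ((if i = j then 1 else 0) - 1 / (n + 1))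

/-- Project the standard basis of ℝⁿ⁺¹ onto the hyperplane orthogonal to (1, …, 1) and identify it
isometrically with ℝⁿ. -/
theorem exists_isCentredRegular (n : ℕ) :
    ∃ p : Fin (n + 1) → EuclideanSpace ℝ (Fin n), IsCentredRegular p 1 := by
  set o : EuclideanSpace ℝ (Fin (n + 1)) := WithLp.toLp 2 fun _ ↦ (1 : ℝ) with ho
  have hio : ∀ x : EuclideanSpace ℝ (Fin (n + 1)), inner ℝ o x = ∑ i, x i := fun x ↦ by
    simp [ho, PiLp.inner_apply]
  have ho0 : o ≠ 0 := fun h ↦ by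
    have := congrArg (fun x : EuclideanSpace ℝ (Fin (n + 1)) ↦ x 0) h
    simp [ho] at this
  have hfact : Fact (Module.finrank ℝ (EuclideanSpace ℝ (Fin (n + 1))) = n + 1) := ⟨by simp⟩
  set φ := (OrthonormalBasis.fromOrthogonalSpanSingleton (𝕜 := ℝ) n ho0).repr
  have hn : (n : ℝ) + 1 ≠ 0 := by positivity
  set w : Fin (n + 1) → EuclideanSpace ℝ (Fin (n + 1)) := fun i ↦
    EuclideanSpace.single i (1 : ℝ) - (1 / (n + 1 : ℝ)) • o with hw
  have hwmem : ∀ i, w i ∈ (Submodule.span ℝ {o})ᗮ := fun i ↦ by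
    rw [Submodule.mem_orthogonal_singleton_iff_inner_right, hw, inner_sub_right, inner_smul_right,
      hio, hio]
    simp [ho, hn]
  refine ⟨fun i ↦ φ ⟨w i, hwmem i⟩, fun i j ↦ ?_⟩
  rw [LinearIsometryEquiv.inner_map_map, Submodule.coe_inner]
  have h1 : inner ℝ (w i) (w j) =
      inner ℝ (EuclideanSpace.single i (1 : ℝ) : EuclideanSpace ℝ (Fin (n + 1))) (w j) := by
    simp only [hw]
    rw [inner_sub_left, inner_smul_left]
    have := Submodule.mem_orthogonal_singleton_iff_inner_right.1 (hwmem j)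
    simp only [hw] at this
    rw [this]; simp
  change inner ℝ (w i) (w j) = _
  rw [h1, EuclideanSpace.inner_single_left]
  simp [hw, ho]

variable {p : Fin (n + 1) → EuclideanSpace ℝ (Fin n)} {a : ℝ}

theorem IsCentredRegular.smul (h : IsCentredRegular p a) (t : ℝ) :
    IsCentredRegular (fun i ↦ t • p i) (t ^ 2 * a) := fun i j ↦ by
  rw [inner_smul_left, inner_smul_right, h i j]
  simp only [conj_trivial]; ring

theorem IsCentredRegular.sum_eq_zero (h : IsCentredRegular p a) : ∑ i, p i = 0 := by
  rw [← inner_self_eq_zero (𝕜 := ℝ), sum_inner]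
  refine Finset.sum_eq_zero fun i _ ↦ ?_
  rw [inner_sum]
  simp only [h i, ← Finset.mul_sum, Finset.sum_sub_distrib]
  have : (n : ℝ) + 1 ≠ 0 := by positivity
  simp [this]

theorem IsCentredRegular.affineIndependent (h : IsCentredRegular p a) (ha : 0 < a) :
    AffineIndependent ℝ p := by
  rw [affineIndependent_iff]
  intro s w hw0 hw i hi
  have h1 := congrArg (fun x ↦ inner ℝ x (p i)) hw
  simp only [sum_inner, inner_smul_left, inner_zero_left, conj_trivial] at h1
  have h2 : ∀ j ∈ s, w j * inner ℝ (p j) (p i) =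
      a * (if j = i then w j else 0) - a / (n + 1) * w j := fun j _ ↦ by
    rw [h j i]
    split_ifs <;> ring
  rw [Finset.sum_congr rfl h2, Finset.sum_sub_distrib, ← Finset.mul_sum, ← Finset.mul_sum, hw0,
    mul_zero, sub_zero, Finset.sum_ite_eq' s i w, if_pos hi] at h1
  exact (mul_eq_zero.1 h1).resolve_left ha.ne'

theorem IsCentredRegular.dist_sq (h : IsCentredRegular p a) {i j : Fin (n + 1)} (hij : i ≠ j) :
    dist (p i) (p j) ^ 2 = 2 * a := by
  rw [dist_eq_norm, norm_sub_sq_real, ← real_inner_self_eq_norm_sq, ← real_inner_self_eq_norm_sq,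
    h, h, h, if_pos rfl, if_pos rfl, if_neg hij]
  ring

theorem IsCentredRegular.span (h : IsCentredRegular p a) (ha : 0 < a) :
    affineSpan ℝ (range p) = ⊤ := by
  rw [(h.affineIndependent ha).affineSpan_eq_top_iff_card_eq_finrank_add_one]
  simp

/-- The reflection exchanging two vertices of a centred regular simplex. -/
theorem IsCentredRegular.exists_swap (h : IsCentredRegular p a) (i j : Fin (n + 1)) :
    ∃ R : 𝔼 ≃ₗᵢ[ℝ] 𝔼, (∀ x, R (R x) = x) ∧ R (p i) = p j ∧ R (p j) = p i ∧
      ∀ k, k ≠ i → k ≠ j → R (p k) = p k := by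
  have hnorm : ‖p i‖ = ‖p j‖ := by
    rw [← sq_eq_sq₀ (norm_nonneg _) (norm_nonneg _), ← real_inner_self_eq_norm_sq,
      ← real_inner_self_eq_norm_sq, h, h, if_pos rfl, if_pos rfl]
  have h1 : (ℝ ∙ (p i - p j))ᗮ.reflection (p i) = p j := Submodule.reflection_sub hnorm
  refine ⟨(ℝ ∙ (p i - p j))ᗮ.reflection, Submodule.reflection_reflection _, h1, ?_,
    fun k hki hkj ↦ ?_⟩
  · have h2 := congrArg (ℝ ∙ (p i - p j))ᗮ.reflection h1
    rw [Submodule.reflection_reflection] at h2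
    exact h2.symm
  · refine Submodule.reflection_mem_subspace_eq_self ?_
    rw [Submodule.mem_orthogonal_singleton_iff_inner_right, inner_sub_left, h, h,
      if_neg hki.symm, if_neg hkj.symm, sub_self]

/-- The reflection swapping two vertices preserves the simplex and volume and is self-adjoint, so it
moves from x to the other argument. -/
theorem IsCentredRegular.integral_invariant (h : IsCentredRegular p a) (i j : Fin (n + 1)) :
    ∃ R : 𝔼 ≃ₗᵢ[ℝ] 𝔼, R (p i) = p j ∧ (∀ k, k ≠ i → k ≠ j → R (p k) = p k) ∧
      (∀ η, ∫ x in convexHull ℝ (range p), inner ℝ x (R η) =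
        ∫ x in convexHull ℝ (range p), inner ℝ x η) ∧
      ∀ η ζ, ∫ x in convexHull ℝ (range p), inner ℝ x (R η) * inner ℝ x (R ζ) =
        ∫ x in convexHull ℝ (range p), inner ℝ x η * inner ℝ x ζ := by
  obtain ⟨R, hRR, hi, hj, hk⟩ := h.exists_swap i j
  have hsub : R '' convexHull ℝ (range p) ⊆ convexHull ℝ (range p) := by
    have e : R '' convexHull ℝ (range p) = convexHull ℝ (R '' range p) :=
      LinearMap.image_convexHull R.toLinearEquiv.toLinearMap (range p)
    rw [e]
    refine convexHull_mono ?_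
    rintro _ ⟨_, ⟨k, rfl⟩, rfl⟩
    by_cases hki : k = i
    · rw [hki, hi]; exact mem_range_self j
    by_cases hkj : k = j
    · rw [hkj, hj]; exact mem_range_self i
    · rw [hk k hki hkj]; exact mem_range_self k
  have hpre : R ⁻¹' convexHull ℝ (range p) = convexHull ℝ (range p) := by
    apply Subset.antisymm
    · intro x hx
      rw [← hRR x]
      exact hsub ⟨R x, hx, rfl⟩
    · exact fun x hx ↦ hsub ⟨x, hx, rfl⟩
  have hinv : ∀ f : 𝔼 → ℝ, ∫ x in convexHull ℝ (range p), f (R x) =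
      ∫ x in convexHull ℝ (range p), f x := fun f ↦ by
    have := R.measurePreserving.setIntegral_preimage_emb R.toHomeomorph.measurableEmbedding f
      (convexHull ℝ (range p))
    rwa [hpre] at this
  have hadj : ∀ x η, inner ℝ (R x) η = inner ℝ x (R η) := fun x η ↦ by
    rw [← R.inner_map_map x (R η), hRR]
  refine ⟨R, hi, hk, fun η ↦ ?_, fun η ζ ↦ ?_⟩
  · rw [← hinv fun x ↦ inner ℝ x η]
    simp only [hadj]
  · rw [← hinv fun x ↦ inner ℝ x η * inner ℝ x ζ]
    simp only [hadj]

theorem isCompact_convexHull_range (p : Fin (n + 1) → 𝔼) :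
    IsCompact (convexHull ℝ (range p)) :=
  (finite_range p).isCompact_convexHull ℝ

theorem exists_sum_smul_eq (hp : affineSpan ℝ (range p) = ⊤) (hi : AffineIndependent ℝ p) (ξ : 𝔼) :
    ∃ c : Fin (n + 1) → ℝ, ∑ i, c i • p i = ξ :=
  ⟨_, (⟨p, hi, hp⟩ : AffineBasis (Fin (n + 1)) ℝ 𝔼).linear_combination_coord_eq_self ξ⟩

/-- By symmetry the barycentre has the same inner product with every vertex. These sum to zero, so
each vanishes, and the vertices span. -/
theorem IsCentredRegular.barycentre (h : IsCentredRegular p a) (ha : 0 < a) :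
    ∫ x in convexHull ℝ (range p), x = 0 := by
  have hKc := isCompact_convexHull_range p
  have hA : ∀ η, ∫ x in convexHull ℝ (range p), inner ℝ x η =
      inner ℝ (∫ x in convexHull ℝ (range p), x) η := fun η ↦ by
    have h := integral_inner (𝕜 := ℝ) (μ := volume.restrict (convexHull ℝ (range p)))
      (f := fun x : 𝔼 ↦ x) (integrableOn_of_continuous hKc continuous_id) η
    simpa only [real_inner_comm] using h
  set w := ∫ x in convexHull ℝ (range p), x with hw
  have heq : ∀ i j, inner ℝ w (p i) = inner ℝ w (p j) := fun i j ↦ by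
    obtain ⟨R, hi, -, hR, -⟩ := h.integral_invariant i j
    rw [← hA, ← hA, ← hi, hR]
  have hzero : ∀ i, inner ℝ w (p i) = 0 := fun i ↦ by
    have h1 : ∑ j, inner ℝ w (p j) = 0 := by rw [← inner_sum, h.sum_eq_zero, inner_zero_right]
    simp only [heq _ i, Finset.sum_const, Finset.card_univ, Fintype.card_fin, nsmul_eq_mul] at h1
    exact (mul_eq_zero.1 h1).resolve_left (by positivity)
  obtain ⟨c, hc⟩ := exists_sum_smul_eq (h.span ha) (h.affineIndependent ha) w
  rw [← inner_self_eq_zero (𝕜 := ℝ)]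
  nth_rewrite 2 [← hc]
  rw [inner_sum]
  exact Finset.sum_eq_zero fun i _ ↦ by rw [inner_smul_right, hzero, mul_zero]

/-- By symmetry the inertia form has one value on the diagonal pairs of vertices and one off them,
related through ∑ p i = 0. It is thus proportional to the Gram matrix, and the vertices span. -/
theorem IsCentredRegular.second_moment (hn : 1 ≤ n) (h : IsCentredRegular p a) (ha : 0 < a) :
    ∃ α : ℝ, ∀ ξ, ∫ x in convexHull ℝ (range p), inner ℝ x ξ ^ 2 = α * ‖ξ‖ ^ 2 := by
  have hKc := isCompact_convexHull_range p
  have hn0 : (0 : ℝ) < n := by exact_mod_cast hn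
  set Q : 𝔼 → 𝔼 → ℝ := fun η ζ ↦ ∫ x in convexHull ℝ (range p), inner ℝ x η * inner ℝ x ζ with hQ
  have hint : ∀ η ζ : 𝔼, IntegrableOn (fun x : 𝔼 ↦ inner ℝ x η * inner ℝ x ζ)
      (convexHull ℝ (range p)) := fun η ζ ↦ integrableOn_of_continuous hKc (by fun_prop)
  have hQsum : ∀ (η : 𝔼) (c : Fin (n + 1) → ℝ), Q η (∑ i, c i • p i) = ∑ i, c i * Q η (p i) := by
    intro η c
    simp only [hQ, inner_sum, inner_smul_right, Finset.mul_sum]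
    rw [integral_finsetSum]
    · refine Finset.sum_congr rfl fun i _ ↦ ?_
      rw [← integral_const_mul]
      exact integral_congr_ae (.of_forall fun x ↦ by ring)
    · intro i _
      refine ((hint η (p i)).const_mul (c i)).congr (.of_forall fun x ↦ ?_)
      ring
  have hQcomm : ∀ η ζ, Q η ζ = Q ζ η := fun η ζ ↦ by simp only [hQ, mul_comm]
  have hdiag : ∀ i j, Q (p i) (p i) = Q (p j) (p j) := fun i j ↦ by
    obtain ⟨R, hi, -, -, hR⟩ := h.integral_invariant i j
    simp only [hQ]
    rw [← hi, hR]
  have hoff : ∀ i j k, j ≠ i → k ≠ i → Q (p i) (p j) = Q (p i) (p k) := fun i j k hji hki ↦ by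
    obtain ⟨R, hj, hfix, -, hR⟩ := h.integral_invariant j k
    simp only [hQ]
    rw [← hR (p i) (p j), hfix i hji.symm hki.symm, hj]
  set q := Q (p 0) (p 0) with hq
  -- The factor is q divided by ‖p i‖² = a n/(n+1).
  have hval : ∀ i j, Q (p i) (p j) = (q * (n + 1) / (n * a)) * inner ℝ (p i) (p j) := by
    intro i j
    rw [h i j]
    rcases eq_or_ne i j with rfl | hij
    · rw [if_pos rfl, hdiag i 0, ← hq]
      field_simp
      ring
    · have h0 : ∑ k, Q (p i) (p k) = 0 := by
        have e := hQsum (p i) fun _ ↦ 1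
        simp only [one_smul, one_mul] at e
        rw [← e, h.sum_eq_zero]
        simp [hQ]
      rw [← Finset.add_sum_erase _ _ (Finset.mem_univ i),
        Finset.sum_congr rfl fun k hk ↦ hoff i k j (Finset.ne_of_mem_erase hk) hij.symm,
        Finset.sum_const, Finset.card_erase_of_mem (Finset.mem_univ i), Finset.card_univ,
        Fintype.card_fin, Nat.add_sub_cancel, nsmul_eq_mul, hdiag i 0, ← hq] at h0
      have h1 : Q (p i) (p j) = -q / n := by
        field_simp
        linarith
      rw [h1, if_neg hij]
      field_simp
      ring
  refine ⟨q * (n + 1) / (n * a), fun ξ ↦ ?_⟩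
  obtain ⟨c, hc⟩ := exists_sum_smul_eq (h.span ha) (h.affineIndependent ha) ξ
  have e1 : ∫ x in convexHull ℝ (range p), inner ℝ x ξ ^ 2 = Q ξ ξ := by simp only [hQ, sq]
  have e2 : ∀ i, Q ξ (p i) = (q * (n + 1) / (n * a)) * inner ℝ ξ (p i) := fun i ↦ by
    rw [hQcomm, ← hc, hQsum, sum_inner, Finset.mul_sum]
    refine Finset.sum_congr rfl fun j _ ↦ ?_
    rw [hval, inner_smul_left, conj_trivial, real_inner_comm]
    ring
  have e3 : inner ℝ ξ ξ = ∑ i, c i * inner ℝ ξ (p i) := by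
    simp only [← inner_smul_right, ← inner_sum, hc]
  rw [e1, ← real_inner_self_eq_norm_sq, e3, Finset.mul_sum]
  calc Q ξ ξ = Q ξ (∑ i, c i • p i) := by rw [hc]
    _ = ∑ i, c i * Q ξ (p i) := hQsum ξ c
    _ = _ := Finset.sum_congr rfl fun i _ ↦ by rw [e2]; ring

theorem exists_isotropic_regularSimplex (hn : 1 ≤ n) :
    ∃ K : Set 𝔼, IsIsotropicBody K ∧ IsRegularSimplex K := by
  obtain ⟨p₀, hp₀⟩ := exists_isCentredRegular n
  have hint₀ : (interior (convexHull ℝ (range p₀))).Nonempty :=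
    interior_convexHull_nonempty_iff_affineSpan_eq_top.2 (hp₀.span one_pos)
  have hc₀ := isCompact_convexHull_range p₀
  set v := (volume (convexHull ℝ (range p₀))).toReal with hv
  have hv' : volume (convexHull ℝ (range p₀)) = ENNReal.ofReal v :=
    (ENNReal.ofReal_toReal hc₀.measure_lt_top.ne).symm
  have hvpos : 0 < v := ENNReal.toReal_pos
    (Measure.measure_pos_of_nonempty_interior _ hint₀).ne' hc₀.measure_lt_top.ne
  set t := (v ^ ((n : ℝ)⁻¹))⁻¹ with ht
  have htpos : 0 < t := inv_pos.2 (Real.rpow_pos_of_pos hvpos _)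
  have htn : t ^ n * v = 1 := by
    rw [ht, inv_pow, Real.rpow_inv_natCast_pow hvpos.le (by omega), inv_mul_cancel₀ hvpos.ne']
  have hp := hp₀.smul t
  have ha : 0 < t ^ 2 * 1 := by positivity
  set p : Fin (n + 1) → 𝔼 := fun i ↦ t • p₀ i with hpdef
  set K := convexHull ℝ (range p) with hK
  have hKt : K = t • convexHull ℝ (range p₀) := by
    rw [← convexHull_smul, ← image_smul, ← range_comp]
    rfl
  have hint : (interior K).Nonempty :=
    interior_convexHull_nonempty_iff_affineSpan_eq_top.2 (hp.span ha)
  have hKc : IsCompact K := isCompact_convexHull_range p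
  have hK1 : volume K = 1 := by
    rw [hKt, Measure.addHaar_smul_of_nonneg _ htpos.le, finrank_euclideanSpace_fin, hv',
      ← ENNReal.ofReal_mul (by positivity), htn, ENNReal.ofReal_one]
  obtain ⟨α, hα⟩ := hp.second_moment hn ha
  -- If α were zero, almost all of K would lie in the hyperplane orthogonal to ξ, so K would be
  -- null.
  have hαpos : 0 < α := by
    have hξ : ‖(EuclideanSpace.single ⟨0, hn⟩ 1 : 𝔼)‖ = 1 := by simp
    set ξ : 𝔼 := EuclideanSpace.single ⟨0, hn⟩ 1
    have hαξ := hα ξ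
    rw [hξ, one_pow, mul_one] at hαξ
    have hnn : 0 ≤ α := by
      rw [← hαξ]; exact integral_nonneg fun x ↦ sq_nonneg _
    refine lt_of_le_of_ne hnn fun h0 ↦ ?_
    rw [← h0, setIntegral_eq_zero_iff_of_nonneg_ae (.of_forall fun x ↦ sq_nonneg _)
      (integrableOn_of_continuous hKc (by fun_prop)), EventuallyEq,
      ae_restrict_iff' hKc.measurableSet] at hαξ
    have hξ0 : ξ ≠ 0 := by rintro h; rw [h] at hξ; simp at hξ
    have hne : ∀ᵐ x : 𝔼, inner ℝ ξ x ≠ 0 := measure_eq_zero_iff_ae_notMem.1 (volume_hyperplane hξ0 0)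
    have : volume K = 0 := by
      rw [measure_eq_zero_iff_ae_notMem]
      filter_upwards [hαξ, hne] with x h1 h2 hx
      have := h1 hx
      simp only [Pi.zero_apply, pow_eq_zero_iff two_ne_zero] at this
      rw [real_inner_comm] at this
      exact h2 this
    rw [hK1] at this
    exact one_ne_zero this
  refine ⟨K, ⟨⟨convex_convexHull ℝ _, hKc, hint⟩, hK1, hp.barycentre ha, Real.sqrt α,
    Real.sqrt_pos.2 hαpos, fun ξ hξ ↦ ?_⟩, ⟨p, hp.affineIndependent ha⟩,
    ⟨Real.sqrt (2 * (t ^ 2 * 1)), fun i j hij ↦ ?_⟩, rfl⟩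
  · rw [Real.sq_sqrt hαpos.le, hα ξ, hξ]; simp
  · exact (Real.sqrt_eq_iff_eq_sq (by positivity) dist_nonneg).2 (hp.dist_sq hij).symm |>.symm

end RegularSimplex

/-! ### The constant and the main theorem -/

theorem maxPerimeter_constant_eq {n : ℕ} (hn : 1 ≤ n) {L : ℝ} (hL : 0 < L) :
    ENNReal.ofReal L * ENNReal.ofReal (n / (L * Real.sqrt ((n + 2) / n))) =
      ENNReal.ofReal (Real.sqrt ((n : ℝ) / ((n : ℝ) + 2)) * (n : ℝ)) := by
  have hn0 : (0 : ℝ) < n := by exact_mod_cast hn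
  rw [← ENNReal.ofReal_mul hL.le]
  congr 1
  have : Real.sqrt ((n : ℝ) / (n + 2)) = (Real.sqrt ((n + 2) / n))⁻¹ := by
    rw [← Real.sqrt_inv, inv_div]
  rw [this]
  have hpos : 0 < Real.sqrt ((n + 2) / (n : ℝ)) := Real.sqrt_pos.2 (by positivity)
  field_simp

end MaxPerimeter

theorem mainTheorem3 (n : ℕ) (hn : 1 ≤ n) :
    (∀ (K : Set (EuclideanSpace ℝ (Fin n))) (L : ℝ),
      MaxPerimeter.IsIsotropicBody K → MaxPerimeter.IsIsotropicConstant K L →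
        MaxPerimeter.maxPerimeter (MaxPerimeter.bodyMeasure K L)
            = ENNReal.ofReal L * MaxPerimeter.surfaceArea K ∧
        MaxPerimeter.maxPerimeter (MaxPerimeter.bodyMeasure K L)
            ≤ ENNReal.ofReal (Real.sqrt ((n : ℝ) / ((n : ℝ) + 2)) * (n : ℝ))) ∧
    (∀ (K : Set (EuclideanSpace ℝ (Fin n))) (L : ℝ),
      MaxPerimeter.IsIsotropicBody K → MaxPerimeter.IsIsotropicConstant K L →
        MaxPerimeter.IsRegularSimplex K →
          MaxPerimeter.maxPerimeter (MaxPerimeter.bodyMeasure K L)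
            = ENNReal.ofReal (Real.sqrt ((n : ℝ) / ((n : ℝ) + 2)) * (n : ℝ))) ∧
    (∃ K : Set (EuclideanSpace ℝ (Fin n)),
      MaxPerimeter.IsIsotropicBody K ∧ MaxPerimeter.IsRegularSimplex K) := by
  have hn0 : (0 : ℝ) < n := by exact_mod_cast hn
  have hr : ∀ {L : ℝ}, 0 < L → 0 < L * Real.sqrt ((n + 2) / n) := fun hL ↦
    mul_pos hL (Real.sqrt_pos.2 (by positivity))
  have h0 : ∀ {K : Set (EuclideanSpace ℝ (Fin n))} {L : ℝ}, MaxPerimeter.IsIsotropicBody K →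
      MaxPerimeter.IsIsotropicConstant K L → (0 : EuclideanSpace ℝ (Fin n)) ∈ interior K :=
    fun hK hL ↦ mem_interior_iff_mem_nhds.2 (Filter.mem_of_superset
      (Metric.closedBall_mem_nhds _ (hr hL.1)) (MaxPerimeter.closedBall_subset_of_isotropic hn hK hL))
  have hmain : ∀ {K : Set (EuclideanSpace ℝ (Fin n))} {L : ℝ}, MaxPerimeter.IsIsotropicBody K →
      MaxPerimeter.IsIsotropicConstant K L →
      MaxPerimeter.maxPerimeter (MaxPerimeter.bodyMeasure K L) =
        ENNReal.ofReal L * MaxPerimeter.perimeter volume K := fun hK hL ↦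
    MaxPerimeter.maxPerimeter_bodyMeasure hn hK.1 (h0 hK hL) hL.1
  have hle : ∀ {K : Set (EuclideanSpace ℝ (Fin n))} {L : ℝ}, MaxPerimeter.IsIsotropicBody K →
      MaxPerimeter.IsIsotropicConstant K L →
      MaxPerimeter.maxPerimeter (MaxPerimeter.bodyMeasure K L) ≤
        ENNReal.ofReal (Real.sqrt ((n : ℝ) / ((n : ℝ) + 2)) * (n : ℝ)) := fun hK hL ↦ by
    have h := MaxPerimeter.perimeter_volume_le_of_closedBall_subset hK.1.1 hK.1.2.1 (hr hL.1)
      (MaxPerimeter.closedBall_subset_of_isotropic hn hK hL)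
    rw [hK.2.1, mul_one] at h
    rw [hmain hK hL, ← MaxPerimeter.maxPerimeter_constant_eq hn hL.1]
    exact mul_le_mul_right h _
  refine ⟨fun K L hK hL ↦ ⟨?_, hle hK hL⟩, fun K L hK hL hs ↦ le_antisymm (hle hK hL) ?_,
    MaxPerimeter.exists_isotropic_regularSimplex hn⟩
  · rw [hmain hK hL, MaxPerimeter.perimeter_volume_eq_surfaceArea hn hK.1 (h0 hK hL)]
  · obtain ⟨s, -, rfl⟩ := hs
    rw [hmain hK hL, ← MaxPerimeter.maxPerimeter_constant_eq hn hL.1]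
    have hspan : affineSpan ℝ (range s.points) = ⊤ := by
      rw [s.independent.affineSpan_eq_top_iff_card_eq_finrank_add_one]; simp
    exact mul_le_mul_right (MaxPerimeter.le_perimeter_of_simplex hn
      ⟨s.points, s.independent, hspan⟩ hK hL) _
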